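/- Let $B$ (blue) and $R$ (red) be two finite sets of at most $n$ points in $\mathbb{R}^2$ such that $B\cup R$ has at least three points and is in general position: no point has both colours, all $x$-coordinates are distinct, all $y$-coordinates are distinct, and no three points are collinear. A \emph{wedge} is one of the four closed regions induced by a pair of intersecting lines (neither parallel nor equal), and a \emph{double wedge} is the union of two opposite such regions. For a region $W_B$ let $W_R=\mathbb{R}^2\setminus W_B$, let $k_R=|R\cap \mathrm{int}(W_B)|$ be the number of red outliers, $k_B=|B\cap \mathrm{int}(W_R)|$ the number of blue outliers, and $k=k_R+k_B$. Consider, for either of the two shapes (wedge or double wedge), any of the following three problems: (a) minimize $k_R$ over all regions $W_B$ of that shape without blue outliers ($k_B=0$); (b) minimize $k_B$ over all regions $W_B$ of that shape without red outliers ($k_R=0$); (c) minimize $k$ over all regions $W_B$ of that shape. Then there is an algorithm on a unit-cost real RAM (exact real arithmetic $+,-,\cdot,/$ and comparisons, integer words of $O(\log n)$ bits used for indexing, no conversion of reals to integers) that, given the coordinates of the points of $B$ and of $R$ in any order, outputs two intersecting lines and the choice of the region induced by them that is an optimal $W_B$ for the problem, in $O(n^4)$ time. -/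

import Mathlib

namespace BichromaticSeparation

/-! ### Lines, wedges and double wedges -/

/-- The plane; the product topology is the Euclidean one. -/
abbrev Plane : Type := ℝ × ℝ

/-- Coefficients of the line `a * x + b * y = c` (a genuine line when `(a, b) ≠ (0, 0)`). -/
structure Line where
  a : ℝ
  b : ℝ
  c : ℝ

namespace Line

/-- The points of the line. -/
def points (l : Line) : Set Plane := {p | l.a * p.1 + l.b * p.2 = l.c}

/-- One of the two closed halfplanes bounded by the line. -/
def lower (l : Line) : Set Plane := {p | l.a * p.1 + l.b * p.2 ≤ l.c}

/-- The other closed halfplane bounded by the line. -/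
def upper (l : Line) : Set Plane := {p | l.c ≤ l.a * p.1 + l.b * p.2}

end Line

/-- Both coefficient triples describe genuine lines, and these are intersecting (they are neither
parallel nor equal): the normal vectors are linearly independent. -/
def Crossing (l m : Line) : Prop := l.a * m.b - m.a * l.b ≠ 0

/-- Crossing lines have exactly one common point. -/
theorem Crossing.existsUnique {l m : Line} (h : Crossing l m) :
    ∃! p : Plane, p ∈ l.points ∧ p ∈ m.points := by
  have h' : l.a * m.b - m.a * l.b ≠ 0 := h
  refine ⟨((l.c * m.b - m.c * l.b) / (l.a * m.b - m.a * l.b),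
    (l.a * m.c - m.a * l.c) / (l.a * m.b - m.a * l.b)), ⟨?_, ?_⟩, ?_⟩
  · change l.a * (_ / _) + l.b * (_ / _) = l.c
    rw [mul_div_assoc', mul_div_assoc', ← add_div, div_eq_iff h']; ring
  · change m.a * (_ / _) + m.b * (_ / _) = m.c
    rw [mul_div_assoc', mul_div_assoc', ← add_div, div_eq_iff h']; ring
  · rintro ⟨x, y⟩ ⟨h1, h2⟩
    change l.a * x + l.b * y = l.c at h1
    change m.a * x + m.b * y = m.c at h2
    ext
    · simp only [eq_div_iff h']; linear_combination m.b * h1 - l.b * h2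
    · simp only [eq_div_iff h']; linear_combination l.a * h2 - m.a * h1

/-- The two kinds of regions under consideration. -/
inductive Shape where
  | wedge
  | doubleWedge

/-- `W` is a wedge: one of the four closed regions induced by a pair of intersecting lines. -/
def IsWedge (W : Set Plane) : Prop :=
  ∃ l m : Line, Crossing l m ∧
    (W = l.lower ∩ m.lower ∨ W = l.lower ∩ m.upper ∨
      W = l.upper ∩ m.lower ∨ W = l.upper ∩ m.upper)

/-- `W` is a double wedge: two opposite closed regions induced by a pair of intersecting lines
(hourglasses and bowties are both included). -/
def IsDoubleWedge (W : Set Plane) : Prop :=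
  ∃ l m : Line, Crossing l m ∧
    (W = (l.lower ∩ m.lower) ∪ (l.upper ∩ m.upper) ∨
      W = (l.lower ∩ m.upper) ∪ (l.upper ∩ m.lower))

/-- `W` is a region of the given shape. -/
def IsRegion : Shape → Set Plane → Prop
  | .wedge, W => IsWedge W
  | .doubleWedge, W => IsDoubleWedge W

/-- The region denoted by an output pair of lines. Negating the coefficients of a line exchanges
its two halfplanes, so every region of the shape is denoted by some pair. -/
def region : Shape → Line → Line → Set Plane
  | .wedge, l, m => l.lower ∩ m.lower
  | .doubleWedge, l, m => (l.lower ∩ m.lower) ∪ (l.upper ∩ m.upper)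

/-! ### Outliers and optimality -/

/-- The number of red outliers: red points in the interior of the blue region `W`. -/
noncomputable def redOutliers (R : Finset Plane) (W : Set Plane) : ℕ :=
  ((R : Set Plane) ∩ interior W).ncard

/-- The number of blue outliers: blue points in the interior of the red region `Wᶜ`. -/
noncomputable def blueOutliers (B : Finset Plane) (W : Set Plane) : ℕ :=
  ((B : Set Plane) ∩ interior Wᶜ).ncard

/-- What is minimized: the number of red outliers (blue outliers are not allowed), the number of
blue outliers (red outliers are not allowed), or the total number of outliers. -/
inductive Objective where
  | red
  | blue
  | total

/-- The regions allowed for an objective. -/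
def Feasible (B R : Finset Plane) (W : Set Plane) : Objective → Prop
  | .red => blueOutliers B W = 0
  | .blue => redOutliers R W = 0
  | .total => True

/-- The quantity to be minimized. -/
noncomputable def value (B R : Finset Plane) (W : Set Plane) : Objective → ℕ
  | .red => redOutliers R W
  | .blue => blueOutliers B W
  | .total => redOutliers R W + blueOutliers B W

/-- `W` is an optimal region of the given shape. -/
def IsOptimal (shape : Shape) (obj : Objective) (B R : Finset Plane) (W : Set Plane) : Prop :=
  IsRegion shape W ∧ Feasible B R W obj ∧
    ∀ W' : Set Plane, IsRegion shape W' → Feasible B R W' obj →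
      value B R W obj ≤ value B R W' obj

/-- General position of the coloured points: no point has both colours, all `x`-coordinates are
distinct, all `y`-coordinates are distinct, and no three points are collinear. -/
def GeneralPosition (B R : Finset Plane) : Prop :=
  Disjoint B R ∧
  Set.InjOn Prod.fst ((B ∪ R : Finset Plane) : Set Plane) ∧
  Set.InjOn Prod.snd ((B ∪ R : Finset Plane) : Set Plane) ∧
  ∀ p ∈ B ∪ R, ∀ q ∈ B ∪ R, ∀ r ∈ B ∪ R, p ≠ q → p ≠ r → q ≠ r →
    ¬ Collinear ℝ ({p, q, r} : Set Plane)

/-! ### The real RAM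

Programs for a real RAM with unit costs, written as structured programs. The memory consists of
arrays of natural numbers and arrays of exact real numbers, with indirect addressing inside an
array. Array names are literals in the program, so a program uses only a fixed number of arrays,
and scalar variables are array cells with a literal index. Reals can be added, subtracted,
multiplied, divided and compared, but not converted to integers. Stored integers must fit in a
word; see `Exec`. -/

/-- A memory state: `nat a i` and `real a i` are the `i`-th cells of the arrays named `a`. -/
structure State where
  nat : ℕ → ℕ → ℕ
  real : ℕ → ℕ → ℝ

namespace State

/-- Overwrite one integer cell. -/
def setNat (s : State) (a i v : ℕ) : State :=
  { s with nat := Function.update s.nat a (Function.update (s.nat a) i v) }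

/-- Overwrite one real cell. -/
def setReal (s : State) (a i : ℕ) (v : ℝ) : State :=
  { s with real := Function.update s.real a (Function.update (s.real a) i v) }

end State

/-- Integer expressions. -/
inductive NatExp where
  | const (k : ℕ)
  | read (a : ℕ) (i : NatExp)
  | add (e f : NatExp)
  | sub (e f : NatExp)
  | mul (e f : NatExp)

namespace NatExp

/-- Value of an integer expression; subtraction is truncated. -/
def eval (s : State) : NatExp → ℕ
  | const k => k
  | read a i => s.nat a (i.eval s)
  | add e f => e.eval s + f.eval s
  | sub e f => e.eval s - f.eval s
  | mul e f => e.eval s * f.eval s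

/-- Every constant, memory access and arithmetic operation costs one step. -/
def cost : NatExp → ℕ
  | const _ => 1
  | read _ i => 1 + i.cost
  | add e f => 1 + e.cost + f.cost
  | sub e f => 1 + e.cost + f.cost
  | mul e f => 1 + e.cost + f.cost

end NatExp

/-- Real expressions. The only constants are integers. -/
inductive RealExp where
  | const (k : ℤ)
  | read (a : ℕ) (i : NatExp)
  | add (e f : RealExp)
  | sub (e f : RealExp)
  | mul (e f : RealExp)
  | div (e f : RealExp)

namespace RealExp

/-- Value of a real expression. Division by zero returns zero, which a program could also achieve
by a test before the division. -/
noncomputable def eval (s : State) : RealExp → ℝ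
  | const k => (k : ℝ)
  | read a i => s.real a (i.eval s)
  | add e f => e.eval s + f.eval s
  | sub e f => e.eval s - f.eval s
  | mul e f => e.eval s * f.eval s
  | div e f => e.eval s / f.eval s

/-- Every constant, memory access and arithmetic operation costs one step. -/
def cost : RealExp → ℕ
  | const _ => 1
  | read _ i => 1 + i.cost
  | add e f => 1 + e.cost + f.cost
  | sub e f => 1 + e.cost + f.cost
  | mul e f => 1 + e.cost + f.cost
  | div e f => 1 + e.cost + f.cost

end RealExp

/-- Tests. -/
inductive Test where
  | natLt (e f : NatExp)
  | realLt (e f : RealExp)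
  | not (b : Test)
  | and (b d : Test)

namespace Test

/-- The test succeeds in state `s`. -/
def Holds (s : State) : Test → Prop
  | natLt e f => e.eval s < f.eval s
  | realLt e f => e.eval s < f.eval s
  | not b => ¬ b.Holds s
  | and b d => b.Holds s ∧ d.Holds s

/-- Every comparison and connective costs one step. -/
def cost : Test → ℕ
  | natLt e f => 1 + e.cost + f.cost
  | realLt e f => 1 + e.cost + f.cost
  | not b => 1 + b.cost
  | and b d => 1 + b.cost + d.cost

end Test

/-- Programs. -/
inductive Prog where
  | skip
  | natSet (a : ℕ) (i e : NatExp)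
  | realSet (a : ℕ) (i : NatExp) (e : RealExp)
  | seq (P Q : Prog)
  | ite (b : Test) (P Q : Prog)
  | while (b : Test) (P : Prog)

/-- `Exec W P s t s'`: started in state `s`, the program `P` halts in state `s'` after exactly `t`
steps, and every integer that it stores is at most `W`. A run that tries to store a larger integer
is stuck, so with `W` polynomial in the input size the machine has words of logarithmic length. -/
inductive Exec (W : ℕ) : Prog → State → ℕ → State → Prop
  | skip (s : State) : Exec W .skip s 1 s
  | natSet (s : State) (a : ℕ) (i e : NatExp) (h : e.eval s ≤ W) :
      Exec W (.natSet a i e) s (1 + i.cost + e.cost) (s.setNat a (i.eval s) (e.eval s))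
  | realSet (s : State) (a : ℕ) (i : NatExp) (e : RealExp) :
      Exec W (.realSet a i e) s (1 + i.cost + e.cost) (s.setReal a (i.eval s) (e.eval s))
  | seq {P Q : Prog} {s s₁ s₂ : State} {t₁ t₂ : ℕ}
      (h₁ : Exec W P s t₁ s₁) (h₂ : Exec W Q s₁ t₂ s₂) :
      Exec W (.seq P Q) s (t₁ + t₂) s₂
  | iteTrue {b : Test} {P Q : Prog} {s s₁ : State} {t : ℕ}
      (hb : b.Holds s) (h : Exec W P s t s₁) :
      Exec W (.ite b P Q) s (1 + b.cost + t) s₁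
  | iteFalse {b : Test} {P Q : Prog} {s s₁ : State} {t : ℕ}
      (hb : ¬ b.Holds s) (h : Exec W Q s t s₁) :
      Exec W (.ite b P Q) s (1 + b.cost + t) s₁
  | whileTrue {b : Test} {P : Prog} {s s₁ s₂ : State} {t₁ t₂ : ℕ}
      (hb : b.Holds s) (h₁ : Exec W P s t₁ s₁) (h₂ : Exec W (.while b P) s₁ t₂ s₂) :
      Exec W (.while b P) s (1 + b.cost + t₁ + t₂) s₂
  | whileFalse {b : Test} {P : Prog} {s : State} (hb : ¬ b.Holds s) :
      Exec W (.while b P) s (1 + b.cost) s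

/-- The machine is deterministic: the running time and the final state are unique. -/
theorem Exec.unique {W : ℕ} {P : Prog} {s s₁ : State} {t₁ : ℕ} (h : Exec W P s t₁ s₁) :
    ∀ {t₂ : ℕ} {s₂ : State}, Exec W P s t₂ s₂ → t₁ = t₂ ∧ s₁ = s₂ := by
  induction h with
  | skip s => intro _ _ h'; cases h'; exact ⟨rfl, rfl⟩
  | natSet s a i e hw => intro _ _ h'; cases h'; exact ⟨rfl, rfl⟩
  | realSet s a i e => intro _ _ h'; cases h'; exact ⟨rfl, rfl⟩
  | seq _ _ ih₁ ih₂ =>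
    intro _ _ h'
    cases h' with
    | seq g₁ g₂ =>
      obtain ⟨rfl, rfl⟩ := ih₁ g₁
      obtain ⟨rfl, rfl⟩ := ih₂ g₂
      exact ⟨rfl, rfl⟩
  | iteTrue hb _ ih =>
    intro _ _ h'
    cases h' with
    | iteTrue _ g => obtain ⟨rfl, rfl⟩ := ih g; exact ⟨rfl, rfl⟩
    | iteFalse hb' _ => exact absurd hb hb'
  | iteFalse hb _ ih =>
    intro _ _ h'
    cases h' with
    | iteTrue hb' _ => exact absurd hb' hb
    | iteFalse _ g => obtain ⟨rfl, rfl⟩ := ih g; exact ⟨rfl, rfl⟩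
  | whileTrue hb _ _ ih₁ ih₂ =>
    intro _ _ h'
    cases h' with
    | whileTrue _ g₁ g₂ =>
      obtain ⟨rfl, rfl⟩ := ih₁ g₁
      obtain ⟨rfl, rfl⟩ := ih₂ g₂
      exact ⟨rfl, rfl⟩
    | whileFalse hb' => exact absurd hb hb'
  | whileFalse hb =>
    intro _ _ h'
    cases h' with
    | whileTrue hb' _ _ => exact absurd hb' hb
    | whileFalse _ => exact ⟨rfl, rfl⟩

/-! ### Input and output -/

/-- The list `l` contains every point of the finite set `S` exactly once. -/
def Enumerates (l : List Plane) (S : Finset Plane) : Prop :=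
  l.Nodup ∧ ∀ p : Plane, p ∈ l ↔ p ∈ S

/-- The initial memory. Cells `0` and `1` of integer array `0` hold the numbers of blue and of red
points; the real arrays `0`, `1`, `2`, `3` hold the `x`- and `y`-coordinates of the blue points and
the `x`- and `y`-coordinates of the red points. Everything else is zero. -/
def inputState (blue red : List Plane) : State where
  nat a i := if a = 0 then (if i = 0 then blue.length else if i = 1 then red.length else 0) else 0
  real a i :=
    if a = 0 then (blue.getD i 0).1
    else if a = 1 then (blue.getD i 0).2
    else if a = 2 then (red.getD i 0).1
    else if a = 3 then (red.getD i 0).2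
    else 0

/-- The line whose coefficients are in the first three cells of the real array `a`. -/
def lineAt (s : State) (a : ℕ) : Line := ⟨s.real a 0, s.real a 1, s.real a 2⟩

end BichromaticSeparation

/-!
Whether a point is an outlier depends only on the signs of two affine functions `f` and `g` at the
point, the zero sets of which are the two lines (`mem_interior_region`,
`mem_interior_compl_region`), and a point on one of the lines is never worse off than it is on one
of the two sides. Therefore each line may be translated until it meets a point and rotated about
this point until it meets a second one: no point changes strictly from one side to the other, so no
new outliers arise (`GenPos.exists_pair`). The three problems are treated at once by minimizing a
weighted number of outliers, where a forbidden outlier weighs more than all others together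
(`isOptimal_of_forall_le`). It remains to find the best among the `O(n ^ 4)` pairs of lines through
two points each, ordered pairs of points giving both orientations of a line.

The lines of a best pair need not cross. If the second one, the line `u v`, is turned about `u` by a
small angle, then only `v` leaves it, and the direction of turning can be chosen so that this does
no harm; all but one of the small angles make the lines cross (`crossing_tilt`,
`totalCost_tilt_le`). A sufficiently small angle is given by an explicit formula, `smallTilt`, so
this is done once, for the best pair.

The costs are computed in constant amortized time per pair. For every `u` the points are sorted by
their slopes at `u`. For a fixed first line the costs of all points on either side of the second
line are tabulated in linear time; then the second line turns about `u`, and every time it passes a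
point `v` only the contribution of `v` changes (`GenPos.sweepCost_add_one`), while the cost of the
line `u v` itself differs from that of the turning line only by the contribution of `v`
(`GenPos.totalCost_add`). The program has loops nested four deep, each with at most as many rounds
as there are points, so its running time is bounded syntactically (`Prog.bound_le`); its correctness
is derived with the rules for `Runs`, in particular the invariant rule `Runs.forLoop`.
-/

namespace BichromaticSeparation

/-! ### Running times and frame conditions of real RAM programs -/

namespace Prog

/-- A bound for the running time when every loop of the program makes at most `N` rounds each time
it is reached. -/
def bound (N : ℕ) : Prog → ℕ
  | skip => 1
  | natSet _ i e => 1 + i.cost + e.cost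
  | realSet _ i e => 1 + i.cost + e.cost
  | seq P Q => P.bound N + Q.bound N
  | ite b P Q => 1 + b.cost + (P.bound N + Q.bound N)
  | .while b P => N * (1 + b.cost + P.bound N) + (1 + b.cost)

/-- The nesting depth of the loops. -/
def depth : Prog → ℕ
  | skip => 0
  | natSet _ _ _ => 0
  | realSet _ _ _ => 0
  | seq P Q => max P.depth Q.depth
  | ite _ P Q => max P.depth Q.depth
  | .while _ P => P.depth + 1

/-- The constant in front of `N ^ depth` in the running time. -/
def coef : Prog → ℕ
  | skip => 1
  | natSet _ i e => 1 + i.cost + e.cost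
  | realSet _ i e => 1 + i.cost + e.cost
  | seq P Q => P.coef + Q.coef
  | ite b P Q => 1 + b.cost + (P.coef + Q.coef)
  | .while b P => 2 * (1 + b.cost) + P.coef

theorem bound_le {N : ℕ} (hN : 1 ≤ N) : ∀ P : Prog, P.bound N ≤ P.coef * N ^ P.depth
  | skip => by simp [bound, coef, depth]
  | natSet a i e => by simp [bound, coef, depth]
  | realSet a i e => by simp [bound, coef, depth]
  | seq P Q => by
    have hP := bound_le hN P
    have hQ := bound_le hN Q
    simp only [bound, coef, depth, add_mul]
    exact add_le_add
      (hP.trans (Nat.mul_le_mul_left _ (Nat.pow_le_pow_right hN (le_max_left _ _))))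
      (hQ.trans (Nat.mul_le_mul_left _ (Nat.pow_le_pow_right hN (le_max_right _ _))))
  | ite b P Q => by
    have hP := bound_le hN P
    have hQ := bound_le hN Q
    simp only [bound, coef, depth, add_mul (1 + b.cost), add_mul P.coef]
    refine add_le_add (Nat.le_mul_of_pos_right _ (Nat.pow_pos hN)) (add_le_add
      (hP.trans (Nat.mul_le_mul_left _ (Nat.pow_le_pow_right hN (le_max_left _ _))))
      (hQ.trans (Nat.mul_le_mul_left _ (Nat.pow_le_pow_right hN (le_max_right _ _)))))
  | .while b P => by
    have hP := bound_le hN P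
    simp only [bound, coef, depth]
    have h1 : 1 ≤ N ^ P.depth := Nat.one_le_pow _ _ hN
    have h2 : 1 ≤ N ^ (P.depth + 1) := Nat.one_le_pow _ _ hN
    have h3 : N * P.bound N ≤ P.coef * N ^ (P.depth + 1) := by
      calc N * P.bound N ≤ N * (P.coef * N ^ P.depth) := Nat.mul_le_mul_left _ hP
        _ = P.coef * N ^ (P.depth + 1) := by ring
    have h4 : N * (1 + b.cost) ≤ (1 + b.cost) * N ^ (P.depth + 1) := by
      calc N * (1 + b.cost) = (1 + b.cost) * (N * 1) := by ring
        _ ≤ (1 + b.cost) * (N * N ^ P.depth) := by gcongr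
        _ = (1 + b.cost) * N ^ (P.depth + 1) := by ring
    have h5 : 1 + b.cost ≤ (1 + b.cost) * N ^ (P.depth + 1) := Nat.le_mul_of_pos_right _ h2
    calc N * (1 + b.cost + P.bound N) + (1 + b.cost)
        = N * (1 + b.cost) + N * P.bound N + (1 + b.cost) := by ring
      _ ≤ (1 + b.cost) * N ^ (P.depth + 1) + P.coef * N ^ (P.depth + 1)
          + (1 + b.cost) * N ^ (P.depth + 1) := by gcongr
      _ = (2 * (1 + b.cost) + P.coef) * N ^ (P.depth + 1) := by ring

/-- The integer arrays to which the program may write. -/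
def natMods : Prog → List ℕ
  | skip => []
  | natSet a _ _ => [a]
  | realSet _ _ _ => []
  | seq P Q => P.natMods ++ Q.natMods
  | ite _ P Q => P.natMods ++ Q.natMods
  | .while _ P => P.natMods

/-- The real arrays to which the program may write. -/
def realMods : Prog → List ℕ
  | skip => []
  | natSet _ _ _ => []
  | realSet a _ _ => [a]
  | seq P Q => P.realMods ++ Q.realMods
  | ite _ P Q => P.realMods ++ Q.realMods
  | .while _ P => P.realMods

end Prog

@[simp] theorem State.setNat_nat (s : State) (a i v b : ℕ) :
    (s.setNat a i v).nat b = if b = a then Function.update (s.nat a) i v else s.nat b := by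
  by_cases h : b = a
  · subst h; simp [State.setNat]
  · simp [State.setNat, h]

@[simp] theorem State.setNat_real (s : State) (a i v : ℕ) : (s.setNat a i v).real = s.real := rfl

@[simp] theorem State.setReal_real (s : State) (a i b : ℕ) (v : ℝ) :
    (s.setReal a i v).real b = if b = a then Function.update (s.real a) i v else s.real b := by
  by_cases h : b = a
  · subst h; simp [State.setReal]
  · simp [State.setReal, h]

@[simp] theorem State.setReal_nat (s : State) (a i : ℕ) (v : ℝ) :
    (s.setReal a i v).nat = s.nat := rfl

/-- The states `s` and `s'` agree outside the integer arrays in `L` and the real arrays in `M`. -/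
structure Frame (L M : List ℕ) (s s' : State) : Prop where
  nat : ∀ a, a ∉ L → s'.nat a = s.nat a
  real : ∀ a, a ∉ M → s'.real a = s.real a

theorem Frame.refl (L M : List ℕ) (s : State) : Frame L M s s := ⟨fun _ _ => rfl, fun _ _ => rfl⟩

theorem Frame.trans {L M : List ℕ} {s s₁ s₂ : State} (h : Frame L M s s₁) (h' : Frame L M s₁ s₂) :
    Frame L M s s₂ :=
  ⟨fun a ha => (h'.nat a ha).trans (h.nat a ha), fun a ha => (h'.real a ha).trans (h.real a ha)⟩

theorem Frame.mono {L M L' M' : List ℕ} {s s' : State} (h : Frame L M s s') (hL : L ⊆ L')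
    (hM : M ⊆ M') : Frame L' M' s s' :=
  ⟨fun a ha => h.nat a fun h' => ha (hL h'), fun a ha => h.real a fun h' => ha (hM h')⟩

theorem Frame.setNat {L M : List ℕ} (s : State) {a : ℕ} (ha : a ∈ L) (i v : ℕ) :
    Frame L M s (s.setNat a i v) :=
  ⟨fun b hb => by rw [State.setNat_nat, if_neg]; rintro rfl; exact hb ha, fun _ _ => rfl⟩

theorem Exec.frame {W : ℕ} {P : Prog} {s s' : State} {t : ℕ} (h : Exec W P s t s') :
    Frame P.natMods P.realMods s s' := by
  induction h with
  | skip s => exact .refl _ _ _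
  | natSet s a i e _ => exact .setNat _ (by simp [Prog.natMods]) _ _
  | realSet s a i e =>
    refine ⟨fun _ _ => rfl, fun b hb => ?_⟩
    have hb' : b ≠ a := by simpa [Prog.realMods] using hb
    simp [hb']
  | seq _ _ ih₁ ih₂ =>
    exact (ih₁.mono (List.subset_append_left _ _) (List.subset_append_left _ _)).trans
      (ih₂.mono (List.subset_append_right _ _) (List.subset_append_right _ _))
  | iteTrue _ _ ih =>
    exact ih.mono (List.subset_append_left _ _) (List.subset_append_left _ _)
  | iteFalse _ _ ih =>
    exact ih.mono (List.subset_append_right _ _) (List.subset_append_right _ _)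
  | whileTrue _ _ _ ih₁ ih₂ => exact Frame.trans ih₁ ih₂
  | whileFalse _ => exact .refl _ _ _

/-- Total correctness with a running time bound: started in `s`, the program halts within
`P.bound N` steps in a state satisfying `Q`, storing only integers up to `W`. -/
def Runs (N W : ℕ) (P : Prog) (s : State) (Q : State → Prop) : Prop :=
  ∃ t s', Exec W P s t s' ∧ t ≤ P.bound N ∧ Q s'

namespace Runs

variable {N W : ℕ} {P P' : Prog} {s : State} {Q Q' : State → Prop}

theorem mono (h : Runs N W P s Q) (hQ : ∀ s', Q s' → Q' s') : Runs N W P s Q' :=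
  let ⟨t, s', h₁, h₂, h₃⟩ := h; ⟨t, s', h₁, h₂, hQ s' h₃⟩

theorem frame (h : Runs N W P s Q) :
    Runs N W P s fun s' => Frame P.natMods P.realMods s s' ∧ Q s' :=
  let ⟨t, s', h₁, h₂, h₃⟩ := h; ⟨t, s', h₁, h₂, h₁.frame, h₃⟩

theorem skip (h : Q s) : Runs N W .skip s Q := ⟨1, s, .skip s, le_rfl, h⟩

theorem natSet {a : ℕ} {i e : NatExp} (hW : e.eval s ≤ W)
    (h : Q (s.setNat a (i.eval s) (e.eval s))) : Runs N W (.natSet a i e) s Q :=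
  ⟨_, _, .natSet s a i e hW, le_rfl, h⟩

theorem realSet {a : ℕ} {i : NatExp} {e : RealExp}
    (h : Q (s.setReal a (i.eval s) (e.eval s))) : Runs N W (.realSet a i e) s Q :=
  ⟨_, _, .realSet s a i e, le_rfl, h⟩

theorem seq (h : Runs N W P s fun s₁ => Runs N W P' s₁ Q) : Runs N W (.seq P P') s Q := by
  obtain ⟨t, s₁, h₁, h₂, t', s₂, h₃, h₄, h₅⟩ := h
  exact ⟨t + t', s₂, .seq h₁ h₃, add_le_add h₂ h₄, h₅⟩

theorem ite {b : Test} (h : b.Holds s → Runs N W P s Q) (h' : ¬ b.Holds s → Runs N W P' s Q) :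
    Runs N W (.ite b P P') s Q := by
  by_cases hb : b.Holds s
  · obtain ⟨t, s₁, h₁, h₂, h₃⟩ := h hb
    exact ⟨_, s₁, .iteTrue hb h₁, Nat.add_le_add_left (h₂.trans (Nat.le_add_right _ _)) _, h₃⟩
  · obtain ⟨t, s₁, h₁, h₂, h₃⟩ := h' hb
    exact ⟨_, s₁, .iteFalse hb h₁, Nat.add_le_add_left (h₂.trans (Nat.le_add_left _ _)) _, h₃⟩

end Runs

/-- `for i < n do P`, where the counter `i` is the scalar stored in the integer array `i` and the
limit `n` is the `j`-th cell of the integer array `a`. -/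
def forLoop (i a j : ℕ) (P : Prog) : Prog :=
  .seq (.natSet i (.const 0) (.const 0))
    (.while (.natLt (.read i (.const 0)) (.read a (.const j)))
      (.seq P (.natSet i (.const 0) (.add (.read i (.const 0)) (.const 1)))))

/-- The invariant rule for counting loops. What the body does not write to is available in the
body and afterwards without being part of the invariant. By `hI`, the invariant must not depend
on the counter cell, which is incremented after the body. -/
theorem Runs.forLoop {N W m i a j : ℕ} {P : Prog} {s : State} {Q : State → Prop}
    (Inv : ℕ → State → Prop) (hm : s.nat a j = m) (hN : m ≤ N) (hW : m ≤ W)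
    (ha : a ∉ i :: P.natMods) (hi : i ∉ P.natMods)
    (hI : ∀ k s v, Inv k s → Inv k (s.setNat i 0 v))
    (h0 : Inv 0 s)
    (step : ∀ k, k < m → ∀ s₁, Frame (i :: P.natMods) P.realMods s s₁ → s₁.nat i 0 = k →
      Inv k s₁ → Runs N W P s₁ (Inv (k + 1)))
    (hQ : ∀ s₁, Frame (i :: P.natMods) P.realMods s s₁ → s₁.nat i 0 = m → Inv m s₁ → Q s₁) :
    Runs N W (forLoop i a j P) s Q := by
  have key : ∀ d k, k + d = m → ∀ s₁, Frame (i :: P.natMods) P.realMods s s₁ → s₁.nat i 0 = k →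
      Inv k s₁ → ∃ t s₂,
        Exec W (.while (.natLt (.read i (.const 0)) (.read a (.const j)))
          (.seq P (.natSet i (.const 0) (.add (.read i (.const 0)) (.const 1))))) s₁ t s₂ ∧
        t ≤ d * (1 + (Test.natLt (.read i (.const 0)) (.read a (.const j))).cost +
          (Prog.seq P (.natSet i (.const 0) (.add (.read i (.const 0)) (.const 1)))).bound N) +
          (1 + (Test.natLt (.read i (.const 0)) (.read a (.const j))).cost) ∧ Q s₂ := by
    intro d
    induction d with
    | zero =>
      intro k hk s₁ hf hi' hinv
      have hk' : k = m := by omega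
      subst hk'
      refine ⟨_, s₁, .whileFalse ?_, by simp, hQ s₁ hf hi' hinv⟩
      simp [Test.Holds, NatExp.eval, hi', hf.nat a ha, hm]
    | succ d ih =>
      intro k hk s₁ hf hi' hinv
      obtain ⟨t, s₂, he, ht, hf₂, hs₂⟩ := (step k (by omega) s₁ hf hi' hinv).frame
      have hi₂ : s₂.nat i 0 = k := by rw [hf₂.nat i hi, hi']
      have hf' : Frame (i :: P.natMods) P.realMods s (s₂.setNat i 0 (k + 1)) :=
        (hf.trans (hf₂.mono (List.subset_cons_self _ _) (List.Subset.refl _))).trans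
          (.setNat _ (by simp) _ _)
      obtain ⟨t', s₃, he', ht', hq⟩ := ih (k + 1) (by omega) _ hf' (by simp) (hI _ _ _ hs₂)
      have hset : Exec W (.natSet i (.const 0) (.add (.read i (.const 0)) (.const 1))) s₂
          ((Prog.natSet i (.const 0) (.add (.read i (.const 0)) (.const 1))).bound N)
          (s₂.setNat i 0 (k + 1)) := by
        have := Exec.natSet (W := W) s₂ i (.const 0) (.add (.read i (.const 0)) (.const 1))
          (by simp only [NatExp.eval, hi₂]; omega)
        simpa only [Prog.bound, NatExp.eval, hi₂] using this
      refine ⟨_, s₃, .whileTrue ?_ (.seq he hset) he', ?_, hq⟩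
      · simp only [Test.Holds, NatExp.eval, hi', hf.nat a ha, hm]; omega
      · have : t + (Prog.natSet i (.const 0) (.add (.read i (.const 0)) (.const 1))).bound N ≤
            (Prog.seq P (.natSet i (.const 0) (.add (.read i (.const 0)) (.const 1)))).bound N :=
          Nat.add_le_add_right ht _
        rw [Nat.succ_mul]; omega
  obtain ⟨t, s₂, he, ht, hq⟩ := key m 0 (by omega) (s.setNat i 0 0) (.setNat _ (by simp) _ _)
    (by simp) (hI _ _ _ h0)
  refine ⟨_, s₂, .seq (.natSet s i (.const 0) (.const 0) (Nat.zero_le _)) he, ?_, hq⟩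
  simp only [BichromaticSeparation.forLoop, Prog.bound]
  refine Nat.add_le_add_left (ht.trans (Nat.add_le_add_right ?_ _)) _
  exact Nat.mul_le_mul_right _ hN

open Topology

/-! ### Outliers in terms of the signs of two affine functions -/

/-- The affine function whose zero set is the line and which is nonpositive on the lower
halfplane. -/
def Line.eval (l : Line) (p : Plane) : ℝ := l.a * p.1 + l.b * p.2 - l.c

/-- The same line with its two halfplanes exchanged. -/
def Line.neg (l : Line) : Line := ⟨-l.a, -l.b, -l.c⟩

theorem Line.mem_lower {l : Line} {p : Plane} : p ∈ l.lower ↔ l.eval p ≤ 0 := by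
  simp [Line.lower, Line.eval]

theorem Line.mem_upper {l : Line} {p : Plane} : p ∈ l.upper ↔ 0 ≤ l.eval p := by
  simp [Line.upper, Line.eval]

theorem Line.neg_eval (l : Line) (p : Plane) : l.neg.eval p = -l.eval p := by
  simp only [Line.neg, Line.eval]; ring

theorem Line.neg_lower (l : Line) : l.neg.lower = l.upper := by
  ext p; rw [mem_lower, mem_upper, neg_eval, neg_nonpos]

theorem Line.neg_upper (l : Line) : l.neg.upper = l.lower := by
  ext p; rw [mem_lower, mem_upper, neg_eval, neg_nonneg]

theorem Line.continuous_eval (l : Line) : Continuous l.eval := by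
  unfold Line.eval; fun_prop

theorem Crossing.neg_right {l m : Line} (h : Crossing l m) : Crossing l m.neg := by
  have h' : l.a * m.b - m.a * l.b ≠ 0 := h
  change l.a * -m.b - -m.a * l.b ≠ 0
  contrapose! h'; linarith

theorem Crossing.neg_left {l m : Line} (h : Crossing l m) : Crossing l.neg m := by
  have h' : l.a * m.b - m.a * l.b ≠ 0 := h
  change -l.a * m.b - m.a * -l.b ≠ 0
  contrapose! h'; linarith

theorem isRegion_iff {shape : Shape} {W : Set Plane} :
    IsRegion shape W ↔ ∃ l m, Crossing l m ∧ W = region shape l m := by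
  cases shape
  · constructor
    · rintro ⟨l, m, h, rfl | rfl | rfl | rfl⟩
      · exact ⟨l, m, h, rfl⟩
      · exact ⟨l, m.neg, h.neg_right, by simp [region, Line.neg_lower]⟩
      · exact ⟨l.neg, m, h.neg_left, by simp [region, Line.neg_lower]⟩
      · exact ⟨l.neg, m.neg, h.neg_left.neg_right, by simp [region, Line.neg_lower]⟩
    · rintro ⟨l, m, h, rfl⟩
      exact ⟨l, m, h, .inl rfl⟩
  · constructor
    · rintro ⟨l, m, h, rfl | rfl⟩
      · exact ⟨l, m, h, rfl⟩
      · exact ⟨l, m.neg, h.neg_right, by simp [region, Line.neg_lower, Line.neg_upper]⟩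
    · rintro ⟨l, m, h, rfl⟩
      exact ⟨l, m, h, .inl rfl⟩

/-- A red point is an outlier, in terms of the values of the two affine functions at the point. -/
def RedBad : Shape → ℝ → ℝ → Prop
  | .wedge, f, g => f < 0 ∧ g < 0
  | .doubleWedge, f, g => 0 < f * g

/-- A blue point is an outlier, in terms of the values of the two affine functions at the point. -/
def BlueBad : Shape → ℝ → ℝ → Prop
  | .wedge, f, g => 0 < f ∨ 0 < g
  | .doubleWedge, f, g => f * g < 0

/-- The directions in which a pair of crossing lines changes its values in a prescribed way. -/
theorem Crossing.exists_direction {l m : Line} (h : Crossing l m) (α β : ℝ) :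
    ∃ d : Plane, ∀ (p : Plane) (t : ℝ),
      l.eval (p + t • d) = l.eval p + t * α ∧ m.eval (p + t • d) = m.eval p + t * β := by
  have h' : l.a * m.b - m.a * l.b ≠ 0 := h
  refine ⟨((α * m.b - β * l.b) / (l.a * m.b - m.a * l.b),
    (l.a * β - m.a * α) / (l.a * m.b - m.a * l.b)), fun p t => ?_⟩
  simp only [Line.eval, Prod.fst_add, Prod.snd_add, Prod.smul_fst, Prod.smul_snd, smul_eq_mul]
  have h₁ : l.a * ((α * m.b - β * l.b) / (l.a * m.b - m.a * l.b)) +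
      l.b * ((l.a * β - m.a * α) / (l.a * m.b - m.a * l.b)) = α := by
    rw [mul_div_assoc', mul_div_assoc', ← add_div, div_eq_iff h']; ring
  have h₂ : m.a * ((α * m.b - β * l.b) / (l.a * m.b - m.a * l.b)) +
      m.b * ((l.a * β - m.a * α) / (l.a * m.b - m.a * l.b)) = β := by
    rw [mul_div_assoc', mul_div_assoc', ← add_div, div_eq_iff h']; ring
  constructor
  · linear_combination t * h₁
  · linear_combination t * h₂

/-- An interior point can be moved a little in every direction. -/
theorem exists_pos_add_smul_mem {W : Set Plane} {p : Plane} (hp : p ∈ interior W) (d : Plane) :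
    ∃ t : ℝ, 0 < t ∧ p + t • d ∈ W := by
  have hc : ContinuousAt (fun t : ℝ => p + t • d) 0 := by fun_prop
  have h1 : ∀ᶠ t : ℝ in 𝓝 0, p + t • d ∈ W := by
    apply hc.eventually_mem
    simpa using mem_interior_iff_mem_nhds.1 hp
  have h2 : ∀ᶠ t : ℝ in 𝓝[>] 0, p + t • d ∈ W := h1.filter_mono nhdsWithin_le_nhds
  obtain ⟨t, ht, ht'⟩ := (h2.and self_mem_nhdsWithin).exists
  exact ⟨t, ht', ht⟩

theorem mem_region_wedge {l m : Line} {p : Plane} :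
    p ∈ region .wedge l m ↔ l.eval p ≤ 0 ∧ m.eval p ≤ 0 := by
  simp only [region, Set.mem_inter_iff, Line.mem_lower]

theorem mem_region_doubleWedge {l m : Line} {p : Plane} :
    p ∈ region .doubleWedge l m ↔ 0 ≤ l.eval p * m.eval p := by
  simp only [region, Set.mem_union, Set.mem_inter_iff, Line.mem_lower, Line.mem_upper,
    mul_nonneg_iff]
  tauto

theorem mem_interior_region {shape : Shape} {l m : Line} (h : Crossing l m) {p : Plane} :
    p ∈ interior (region shape l m) ↔ RedBad shape (l.eval p) (m.eval p) := by
  cases shape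
  · constructor
    · intro hp
      -- in a direction in which both functions increase, a point of a line would leave the wedge
      obtain ⟨d, hd⟩ := h.exists_direction 1 1
      obtain ⟨t, ht, hm⟩ := exists_pos_add_smul_mem hp d
      rw [mem_region_wedge, (hd p t).1, (hd p t).2] at hm
      exact ⟨by linarith [hm.1], by linarith [hm.2]⟩
    · intro hp
      refine mem_interior.2 ⟨{p | l.eval p < 0 ∧ m.eval p < 0}, fun q hq => ?_, ?_, hp⟩
      · exact mem_region_wedge.2 ⟨hq.1.le, hq.2.le⟩
      · exact (isOpen_lt l.continuous_eval continuous_const).inter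
          (isOpen_lt m.continuous_eval continuous_const)
  · constructor
    · intro hp
      have h0 : 0 ≤ l.eval p * m.eval p := mem_region_doubleWedge.1 (interior_subset hp)
      change 0 < l.eval p * m.eval p
      refine lt_of_le_of_ne h0 fun h0 => ?_
      -- near a point of one of the lines there are points where the product is negative
      have key : ∀ α β : ℝ, (∀ t : ℝ, 0 < t → (l.eval p + t * α) * (m.eval p + t * β) < 0) →
          False := by
        intro α β hneg
        obtain ⟨d, hd⟩ := h.exists_direction α β
        obtain ⟨t, ht, hm⟩ := exists_pos_add_smul_mem hp d
        rw [mem_region_doubleWedge, (hd p t).1, (hd p t).2] at hm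
        exact absurd hm (not_le.2 (hneg t ht))
      rcases mul_eq_zero.1 h0.symm with hf | hg
      · rcases le_or_gt 0 (m.eval p) with hg | hg
        · exact key (-1) 1 fun t ht => mul_neg_of_neg_of_pos (by linarith) (by linarith)
        · exact key 1 (-1) fun t ht => mul_neg_of_pos_of_neg (by linarith) (by linarith)
      · rcases le_or_gt 0 (l.eval p) with hf | hf
        · exact key 1 (-1) fun t ht => mul_neg_of_pos_of_neg (by linarith) (by linarith)
        · exact key (-1) 1 fun t ht => mul_neg_of_neg_of_pos (by linarith) (by linarith)
    · intro hp
      refine mem_interior.2 ⟨{p | 0 < l.eval p * m.eval p}, fun q hq => ?_, ?_, hp⟩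
      · exact mem_region_doubleWedge.2 (le_of_lt hq)
      · exact isOpen_lt continuous_const (l.continuous_eval.mul m.continuous_eval)

theorem mem_interior_compl_region {shape : Shape} {l m : Line} {p : Plane} :
    p ∈ interior (region shape l m)ᶜ ↔ BlueBad shape (l.eval p) (m.eval p) := by
  have hcl : IsClosed (region shape l m) := by
    have hl : IsClosed l.lower := isClosed_le (by fun_prop) (by fun_prop)
    have hm : IsClosed m.lower := isClosed_le (by fun_prop) (by fun_prop)
    have hl' : IsClosed l.upper := isClosed_le (by fun_prop) (by fun_prop)
    have hm' : IsClosed m.upper := isClosed_le (by fun_prop) (by fun_prop)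
    cases shape
    · exact hl.inter hm
    · exact (hl.inter hm).union (hl'.inter hm')
  rw [hcl.isOpen_compl.interior_eq, Set.mem_compl_iff]
  cases shape
  · rw [mem_region_wedge, BlueBad, not_and_or, not_le, not_le]
  · rw [mem_region_doubleWedge, BlueBad, not_le]

/-- A point of the given colour is an outlier. -/
def Bad (shape : Shape) (blue : Prop) (f g : ℝ) : Prop :=
  (blue ∧ BlueBad shape f g) ∨ (¬ blue ∧ RedBad shape f g)

theorem Bad.mono {shape : Shape} {blue : Prop} {f g f' g' : ℝ} (h : Bad shape blue f' g')
    (hf : 0 < f' → 0 < f) (hf' : f' < 0 → f < 0) (hg : 0 < g' → 0 < g) (hg' : g' < 0 → g < 0) :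
    Bad shape blue f g := by
  rcases h with ⟨hb, h⟩ | ⟨hb, h⟩
  · refine .inl ⟨hb, ?_⟩
    cases shape
    · exact h.imp hf hg
    · rcases mul_neg_iff.1 h with h | h
      · exact mul_neg_of_pos_of_neg (hf h.1) (hg' h.2)
      · exact mul_neg_of_neg_of_pos (hf' h.1) (hg h.2)
  · refine .inr ⟨hb, ?_⟩
    cases shape
    · exact h.imp hf' hg'
    · rcases mul_pos_iff.1 h with h | h
      · exact mul_pos (hf h.1) (hg h.2)
      · exact mul_pos_of_neg_of_neg (hf' h.1) (hg' h.2)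

/-- A point on the second line can be moved to one of its two sides without harm. -/
theorem Bad.of_both_sides {shape : Shape} {blue : Prop} {f g : ℝ} (h : Bad shape blue f g)
    (h' : Bad shape blue f (-g)) : Bad shape blue f 0 := by
  rcases h with ⟨hb, h⟩ | ⟨hb, h⟩ <;> rcases h' with ⟨hb', h'⟩ | ⟨hb', h'⟩
  · cases shape
    · refine .inl ⟨hb, .inl ?_⟩
      rcases h with h | h
      · exact h
      · rcases h' with h' | h'
        · exact h'
        · linarith
    · change f * g < 0 at h
      change f * -g < 0 at h'
      linarith
  · exact absurd hb hb'
  · exact absurd hb' hb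
  · cases shape
    · linarith [h.2, h'.2]
    · change 0 < f * g at h
      change 0 < f * -g at h'
      linarith

open Classical in
theorem redOutliers_region {shape : Shape} {l m : Line} (h : Crossing l m) (R : Finset Plane) :
    redOutliers R (region shape l m) =
      ∑ p ∈ R, if RedBad shape (l.eval p) (m.eval p) then 1 else 0 := by
  rw [redOutliers, ← Finset.card_filter, ← Set.ncard_coe_finset]
  congr 1
  ext p
  simp [mem_interior_region h]

open Classical in
theorem blueOutliers_region {shape : Shape} {l m : Line} (B : Finset Plane) :
    blueOutliers B (region shape l m) =
      ∑ p ∈ B, if BlueBad shape (l.eval p) (m.eval p) then 1 else 0 := by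
  rw [blueOutliers, ← Finset.card_filter, ← Set.ncard_coe_finset]
  congr 1
  ext p
  rw [Set.mem_inter_iff, mem_interior_compl_region]
  simp

/-! ### Lines through two of the points suffice -/

/-- Twice the signed area of the triangle with the vertices `p`, `q`, `r` of the point sequence with
coordinates `X` and `Y`; as a function of `r`, an affine function vanishing on the line `p q`. -/
def orient (X Y : ℕ → ℝ) (p q r : ℕ) : ℝ :=
  (X q - X p) * (Y r - Y p) - (Y q - Y p) * (X r - X p)

/-- The first `N` points of the sequence are in general position. -/
structure GenPos (X Y : ℕ → ℝ) (N : ℕ) : Prop where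
  x : ∀ i < N, ∀ j < N, i ≠ j → X i ≠ X j
  y : ∀ i < N, ∀ j < N, i ≠ j → Y i ≠ Y j
  noncollinear : ∀ i < N, ∀ j < N, ∀ k < N, i ≠ j → i ≠ k → j ≠ k → orient X Y i j k ≠ 0

/-- Moving `f` within the pencil `f - t * h` until it vanishes at some `v` for the first time:
no value changes its sign, although it may become zero. -/
theorem exists_first_zero {N : ℕ} (f h : ℕ → ℝ) (hex : ∃ v < N, h v ≠ 0) :
    ∃ v < N, h v ≠ 0 ∧ ∀ r < N, (0 < f r - f v / h v * h r → 0 < f r) ∧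
      (f r - f v / h v * h r < 0 → f r < 0) := by
  classical
  obtain ⟨v, hv, hmin⟩ := ((Finset.range N).filter fun r => h r ≠ 0).exists_min_image
    (fun r => |f r / h r|) (by obtain ⟨v, h1, h2⟩ := hex; exact ⟨v, by simp [h1, h2]⟩)
  simp only [Finset.mem_filter, Finset.mem_range] at hv hmin
  refine ⟨v, hv.1, hv.2, fun r hr => ?_⟩
  by_cases h0 : h r = 0
  · simp [h0]
  have h1 : |f v / h v * h r| ≤ |f r| := by
    have := hmin r ⟨hr, h0⟩
    rw [abs_div (f r), le_div_iff₀ (abs_pos.2 h0), ← abs_mul] at this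
    exact this
  constructor
  · intro hpos
    by_contra! hneg
    rw [abs_of_nonpos hneg] at h1
    linarith [neg_abs_le (f v / h v * h r)]
  · intro hneg
    by_contra! hpos
    rw [abs_of_nonneg hpos] at h1
    linarith [le_abs_self (f v / h v * h r)]

theorem orient_swap (X Y : ℕ → ℝ) (p q r : ℕ) : orient X Y q p r = -orient X Y p q r := by
  unfold orient; ring

/-- Every line can be translated and then rotated about a point until it passes through two of the
points, without a point changing strictly from one side to the other. -/
theorem GenPos.exists_pair {X Y : ℕ → ℝ} {N : ℕ} (hg : GenPos X Y N) (hN : 3 ≤ N) {a b : ℝ}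
    (c : ℝ) (hab : a ≠ 0 ∨ b ≠ 0) :
    ∃ p < N, ∃ q < N, p ≠ q ∧ ∀ r < N, (0 < orient X Y p q r → 0 < a * X r + b * Y r - c) ∧
      (orient X Y p q r < 0 → a * X r + b * Y r - c < 0) := by
  obtain ⟨u, hu, -, h1⟩ := exists_first_zero (N := N) (fun r => a * X r + b * Y r - c)
    (fun _ => 1) ⟨0, by omega, one_ne_zero⟩
  have hpos : 0 < a ^ 2 + b ^ 2 := by
    rcases hab with h | h
    · have := sq_pos_of_ne_zero h; positivity
    · have := sq_pos_of_ne_zero h; positivity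
  -- two points other than `u`; not both are on the line through `u` in the direction `(a, b)`
  obtain ⟨v₁, v₂, hv₁, hv₂, h₁u, h₂u, h₁₂⟩ :
      ∃ v₁ v₂, v₁ < N ∧ v₂ < N ∧ v₁ ≠ u ∧ v₂ ≠ u ∧ v₁ ≠ v₂ := by
    rcases Nat.lt_trichotomy u 1 with h | h | h
    · exact ⟨1, 2, by omega, by omega, by omega, by omega, by omega⟩
    · exact ⟨0, 2, by omega, by omega, by omega, by omega, by omega⟩
    · exact ⟨0, 1, by omega, by omega, by omega, by omega, by omega⟩
  obtain ⟨v, hv, hne, h2⟩ := exists_first_zero (N := N)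
    (fun r => a * (X r - X u) + b * (Y r - Y u))
    (fun r => -b * (X r - X u) + a * (Y r - Y u)) (by
      by_contra! hall
      have e₁ := hall v₁ hv₁
      have e₂ := hall v₂ hv₂
      apply hg.noncollinear u hu v₁ hv₁ v₂ hv₂ h₁u.symm h₂u.symm h₁₂
      have ea : a * orient X Y u v₁ v₂ = 0 := by
        unfold orient; linear_combination (X v₁ - X u) * e₂ - (X v₂ - X u) * e₁
      have eb : b * orient X Y u v₁ v₂ = 0 := by
        unfold orient; linear_combination (Y v₁ - Y u) * e₂ - (Y v₂ - Y u) * e₁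
      rcases hab with h | h
      · exact (mul_eq_zero.1 ea).resolve_left h
      · exact (mul_eq_zero.1 eb).resolve_left h)
  have huv : u ≠ v := by rintro rfl; simp at hne
  have hx : X v - X u ≠ 0 := sub_ne_zero.2 (hg.x v hv u hu huv.symm)
  set t := (a * (X v - X u) + b * (Y v - Y u)) / (-b * (X v - X u) + a * (Y v - Y u)) 
  have ht' : a * (X v - X u) + b * (Y v - Y u) = t * (-b * (X v - X u) + a * (Y v - Y u)) :=
    (div_mul_cancel₀ _ hne).symm
  clear_value t
  -- the rotated function is a multiple of `orient X Y u v`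
  have hmul : ∀ r, a * (X r - X u) + b * (Y r - Y u) - t * (-b * (X r - X u) + a * (Y r - Y u)) =
      (b - t * a) / (X v - X u) * orient X Y u v r := by
    intro r
    rw [div_mul_eq_mul_div, eq_div_iff hx]
    unfold orient
    linear_combination (X r - X u) * ht'
  have hB : b - t * a ≠ 0 := by
    intro hB
    have hA : (a + t * b) * (X v - X u) = 0 := by linear_combination ht' - (Y v - Y u) * hB
    have hA' : a + t * b = 0 := (mul_eq_zero.1 hA).resolve_right hx
    have : a ^ 2 + b ^ 2 = 0 := by linear_combination a * hA' + b * hB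
    exact hpos.ne' this
  have hconf : ∀ r < N,
      (0 < (b - t * a) / (X v - X u) * orient X Y u v r → 0 < a * X r + b * Y r - c) ∧
      ((b - t * a) / (X v - X u) * orient X Y u v r < 0 → a * X r + b * Y r - c < 0) := by
    intro r hr
    rw [← hmul r]
    refine ⟨fun h => (h1 r hr).1 ?_, fun h => (h1 r hr).2 ?_⟩
    · have := (h2 r hr).1 h
      linarith
    · have := (h2 r hr).2 h
      linarith
  rcases lt_or_gt_of_ne (div_ne_zero hB hx) with h | h
  · refine ⟨v, hv, u, hu, huv.symm, fun r hr => ?_⟩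
    rw [orient_swap]
    exact ⟨fun h' => (hconf r hr).1 (mul_pos_of_neg_of_neg h (neg_pos.1 h')),
      fun h' => (hconf r hr).2 (mul_neg_of_neg_of_pos h (neg_lt_zero.1 h'))⟩
  · exact ⟨u, hu, v, hv, huv, fun r hr => ⟨fun h' => (hconf r hr).1 (mul_pos h h'),
      fun h' => (hconf r hr).2 (mul_neg_of_pos_of_neg h h')⟩⟩

/-! ### The combined objective -/

/-- The cost of an outlier. Where outliers of one colour are not allowed, one of them costs more
than all outliers of the other colour together. -/
noncomputable def weight (obj : Objective) (N : ℕ) (blue : Prop) : ℕ :=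
  open Classical in
  match obj with
  | .red => if blue then N + 1 else 1
  | .blue => if blue then 1 else N + 1
  | .total => 1

/-- The cost of the `r`-th point, where the points before the `nb`-th are blue. -/
noncomputable def cost (shape : Shape) (obj : Objective) (nb N r : ℕ) (f g : ℝ) : ℕ :=
  open Classical in if Bad shape (r < nb) f g then weight obj N (r < nb) else 0

/-- The cost of the region given by two affine functions with the values `F` and `G`. -/
noncomputable def totalCost (shape : Shape) (obj : Objective) (nb N : ℕ) (F G : ℕ → ℝ) : ℕ :=
  ∑ r ∈ Finset.range N, cost shape obj nb N r (F r) (G r)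

section
variable {shape : Shape} {obj : Objective} {nb N : ℕ}

theorem weight_le (blue : Prop) : weight obj N blue ≤ N + 1 := by
  cases obj <;> simp only [weight] <;> (try split_ifs) <;> omega

theorem cost_le (r : ℕ) (f g : ℝ) : cost shape obj nb N r f g ≤ N + 1 := by
  unfold cost; split_ifs
  · exact weight_le _
  · exact Nat.zero_le _

theorem totalCost_le (F G : ℕ → ℝ) : totalCost shape obj nb N F G ≤ N * (N + 1) := by
  unfold totalCost
  calc _ ≤ ∑ r ∈ Finset.range N, (N + 1) := Finset.sum_le_sum fun r _ => cost_le r _ _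
    _ = N * (N + 1) := by simp

theorem cost_mono {r : ℕ} {f g f' g' : ℝ}
    (h : Bad shape (r < nb) f' g' → Bad shape (r < nb) f g) :
    cost shape obj nb N r f' g' ≤ cost shape obj nb N r f g := by
  unfold cost; split_ifs with h1 h2
  · exact le_rfl
  · exact absurd (h h1) h2
  · exact Nat.zero_le _
  · exact le_rfl

theorem cost_congr {r : ℕ} {f g g' : ℝ} (h : 0 < g ↔ 0 < g') (h' : g < 0 ↔ g' < 0) :
    cost shape obj nb N r f g = cost shape obj nb N r f g' :=
  le_antisymm (cost_mono fun hb => hb.mono id id h.1 h'.1)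
    (cost_mono fun hb => hb.mono id id h.2 h'.2)

end

/-! ### Making the two lines cross -/

/-- The line through two points, with the orientation given by `orient`. -/
def lineThrough (X Y : ℕ → ℝ) (p q : ℕ) : Line :=
  ⟨-(Y q - Y p), X q - X p, -(Y q - Y p) * X p + (X q - X p) * Y p⟩

theorem lineThrough_eval (X Y : ℕ → ℝ) (p q r : ℕ) :
    (lineThrough X Y p q).eval (X r, Y r) = orient X Y p q r := by
  simp only [lineThrough, Line.eval, orient]; ring

/-- The line turned about its point with the first coordinate `x`. -/
def Line.tilt (l : Line) (ε x : ℝ) : Line := ⟨l.a + ε, l.b, l.c + ε * x⟩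

theorem Line.tilt_eval (l : Line) (ε x : ℝ) (p : Plane) :
    (l.tilt ε x).eval p = l.eval p + ε * (p.1 - x) := by
  simp only [Line.tilt, Line.eval]; ring

/-- The determinant deciding whether the lines cross. -/
def Line.det (l m : Line) : ℝ := l.a * m.b - m.a * l.b

/-- An amount of turning of the line `u v` about `u` which keeps the other points on their sides
and makes the line cross the line `l`. Terms with the denominator zero vanish: these are the terms
for `u` and `v`, and the one with the determinant if the lines are parallel. -/
noncomputable def smallTilt (X Y : ℕ → ℝ) (N : ℕ) (l : Line) (u v : ℕ) : ℝ :=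
  1 / (1 + (l.b / l.det (lineThrough X Y u v)) * (l.b / l.det (lineThrough X Y u v)) +
    ∑ r ∈ Finset.range N,
      ((X r - X u) / orient X Y u v r) * ((X r - X u) / orient X Y u v r))

theorem abs_mul_inv_one_add_lt {x g S : ℝ} (hg : g ≠ 0) (hS : x / g * (x / g) ≤ S) :
    |1 / (1 + S) * x| < |g| := by
  have h0 : 0 < 1 + S := by nlinarith [mul_self_nonneg (x / g)]
  rw [abs_mul, abs_of_pos (one_div_pos.2 h0), one_div_mul_eq_div, div_lt_iff₀ h0]
  have h1 : |x / g| < 1 + S := by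
    nlinarith [abs_mul_abs_self (x / g), mul_self_nonneg (|x / g| - 1), abs_nonneg (x / g)]
  rw [abs_div, div_lt_iff₀ (abs_pos.2 hg)] at h1
  linarith

theorem smallTilt_pos (X Y : ℕ → ℝ) (N : ℕ) (l : Line) (u v : ℕ) :
    0 < smallTilt X Y N l u v := by
  have h : 0 ≤ ∑ r ∈ Finset.range N,
      ((X r - X u) / orient X Y u v r) * ((X r - X u) / orient X Y u v r) :=
    Finset.sum_nonneg fun r _ => mul_self_nonneg _
  have := mul_self_nonneg (l.b / l.det (lineThrough X Y u v))
  unfold smallTilt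
  positivity

theorem smallTilt_mul_lt {X Y : ℕ → ℝ} {N : ℕ} (l : Line) {u v r : ℕ} (hr : r < N)
    (h : orient X Y u v r ≠ 0) :
    |smallTilt X Y N l u v * (X r - X u)| < |orient X Y u v r| := by
  unfold smallTilt
  rw [add_assoc]
  refine abs_mul_inv_one_add_lt h ?_
  have := Finset.single_le_sum (f := fun r =>
    ((X r - X u) / orient X Y u v r) * ((X r - X u) / orient X Y u v r))
    (fun r _ => mul_self_nonneg _) (Finset.mem_range.2 hr)
  exact this.trans (le_add_of_nonneg_left (mul_self_nonneg _))

theorem crossing_tilt {X Y : ℕ → ℝ} {N : ℕ} {l : Line} (hl : l.b ≠ 0) {u v : ℕ} {ε x : ℝ}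
    (hε : |ε| = smallTilt X Y N l u v) : Crossing l ((lineThrough X Y u v).tilt ε x) := by
  change l.a * (lineThrough X Y u v).b - ((lineThrough X Y u v).a + ε) * l.b ≠ 0
  have hdet : l.a * (lineThrough X Y u v).b - ((lineThrough X Y u v).a + ε) * l.b =
      l.det (lineThrough X Y u v) - ε * l.b := by unfold Line.det; ring
  rw [hdet]
  have hpos := smallTilt_pos X Y N l u v
  by_cases h0 : l.det (lineThrough X Y u v) = 0
  · rw [h0, zero_sub]
    refine neg_ne_zero.2 (mul_ne_zero ?_ hl)
    rintro rfl
    rw [abs_zero] at hε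
    linarith
  · have h1 : |smallTilt X Y N l u v * l.b| < |l.det (lineThrough X Y u v)| := by
      unfold smallTilt
      rw [add_assoc]
      refine abs_mul_inv_one_add_lt h0 (le_add_of_nonneg_right ?_)
      exact Finset.sum_nonneg fun r _ => mul_self_nonneg _
    rw [abs_mul, abs_of_pos hpos, ← hε, ← abs_mul] at h1
    intro h
    rw [sub_eq_zero.1 h] at h1
    exact lt_irrefl _ h1

/-- The direction of turning is chosen so that `v` is not harmed; then no point is. -/
theorem totalCost_tilt_le {X Y : ℕ → ℝ} {shape : Shape} {obj : Objective} {nb N : ℕ}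
    (hg : GenPos X Y N) {p q u v : ℕ} (hu : u < N) (hv : v < N) (huv : u ≠ v) (l : Line) {ε : ℝ}
    (hε : (Bad shape (v < nb) (orient X Y p q v) (X v - X u) ∧ ε = -smallTilt X Y N l u v) ∨
      (¬ Bad shape (v < nb) (orient X Y p q v) (X v - X u) ∧ ε = smallTilt X Y N l u v)) :
    totalCost shape obj nb N (orient X Y p q)
      (fun r => ((lineThrough X Y u v).tilt ε (X u)).eval (X r, Y r)) ≤
    totalCost shape obj nb N (orient X Y p q) (orient X Y u v) := by
  have hpos := smallTilt_pos X Y N l u v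
  have habs : |ε| = smallTilt X Y N l u v := by
    rcases hε with ⟨-, h⟩ | ⟨-, h⟩
    · rw [h, abs_neg, abs_of_pos hpos]
    · rw [h, abs_of_pos hpos]
  refine Finset.sum_le_sum fun r hr => cost_mono fun hb => ?_
  have hr : r < N := Finset.mem_range.1 hr
  simp only [Line.tilt_eval, lineThrough_eval] at hb
  by_cases hru : r = u
  · subst hru
    simpa using hb
  by_cases hrv : r = v
  · subst hrv
    have h0 : orient X Y u r r = 0 := by unfold orient; ring
    rw [h0, zero_add] at hb
    rw [h0]
    rcases hε with ⟨hb', rfl⟩ | ⟨hb', rfl⟩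
    · refine hb'.of_both_sides (hb.mono id id (fun h => ?_) fun h => ?_)
      · nlinarith
      · nlinarith
    · refine absurd (hb.mono id id (fun h => ?_) fun h => ?_) hb'
      · exact (pos_iff_pos_of_mul_pos h).1 hpos
      · exact (pos_iff_neg_of_mul_neg h).1 hpos
  · have h0 := hg.noncollinear u hu v hv r hr huv (Ne.symm hru) (Ne.symm hrv)
    have h1 := smallTilt_mul_lt l hr h0
    rw [abs_mul, abs_of_pos hpos, ← habs, ← abs_mul] at h1
    rcases lt_or_gt_of_ne h0 with h0 | h0
    · rw [abs_of_neg h0, abs_lt] at h1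
      exact hb.mono id id (fun h => by linarith [h1.2]) fun _ => h0
    · rw [abs_of_pos h0, abs_lt] at h1
      exact hb.mono id id (fun _ => h0) fun h => by linarith [h1.1]

/-! ### Turning a line about a point -/

/-- The slope of the line through the points `u` and `r`; zero, by division by zero, if `r = u`. -/
noncomputable def slope (X Y : ℕ → ℝ) (u r : ℕ) : ℝ := (Y r - Y u) / (X r - X u)

open Classical in
/-- The number of points among the first `m` whose slope at `u` is smaller than that of `v`. -/
noncomputable def rank (X Y : ℕ → ℝ) (m u v : ℕ) : ℕ :=
  ∑ r ∈ Finset.range m, if slope X Y u r < slope X Y u v then 1 else 0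

/-- The side of the `r`-th point with respect to the line through `u`, directed to the right, whose
slope is just below that of the point of rank `k`: the points of smaller rank have been passed. -/
noncomputable def side (X Y : ℕ → ℝ) (N u k r : ℕ) : ℝ :=
  if X u < X r then (if k ≤ rank X Y N u r then 1 else -1)
  else if X r < X u then (if rank X Y N u r < k then 1 else -1) else 0

/-- The cost of the region given by `F` and the turning line at `u`, directed to the right if
`σ = 1` and to the left if `σ = -1`. -/
noncomputable def sweepCost (X Y : ℕ → ℝ) (shape : Shape) (obj : Objective) (nb N : ℕ)
    (F : ℕ → ℝ) (u : ℕ) (σ : ℝ) (k : ℕ) : ℕ :=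
  ∑ r ∈ Finset.range N, cost shape obj nb N r (F r) (σ * side X Y N u k r)

theorem sum_add_eq_sum_add_of_eq_off {N v : ℕ} {f g : ℕ → ℕ} (hv : v < N)
    (h : ∀ r < N, r ≠ v → f r = g r) :
    ∑ r ∈ Finset.range N, f r + g v = ∑ r ∈ Finset.range N, g r + f v := by
  have hv' := Finset.mem_range.2 hv
  rw [← Finset.add_sum_erase _ f hv', ← Finset.add_sum_erase _ g hv',
    Finset.sum_congr rfl fun r hr => h r (Finset.mem_range.1 (Finset.mem_of_mem_erase hr))
      (Finset.ne_of_mem_erase hr)]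
  ring

section
variable {X Y : ℕ → ℝ} {N u : ℕ}

/-- The slopes at `u` are distinct, including that of `u` itself: it is zero, while those of the
other points are not, since no other point has the same height. -/
theorem GenPos.slope_ne (hg : GenPos X Y N) (hu : u < N) {r s : ℕ} (hr : r < N) (hs : s < N)
    (h : r ≠ s) : slope X Y u r ≠ slope X Y u s := by
  have h0 : ∀ r < N, r ≠ u → slope X Y u r ≠ 0 := fun r hr hru =>
    div_ne_zero (sub_ne_zero.2 (hg.y r hr u hu hru)) (sub_ne_zero.2 (hg.x r hr u hu hru))
  have hu0 : slope X Y u u = 0 := by simp [slope]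
  by_cases hru : r = u
  · rw [hru, hu0]
    exact (h0 s hs (by rintro rfl; exact h hru)).symm
  by_cases hsu : s = u
  · rw [hsu, hu0]
    exact h0 r hr hru
  unfold slope
  rw [Ne, div_eq_div_iff (sub_ne_zero.2 (hg.x r hr u hu hru)) (sub_ne_zero.2 (hg.x s hs u hu hsu))]
  intro he
  apply hg.noncollinear u hu r hr s hs (Ne.symm hru) (Ne.symm hsu) h
  unfold orient
  linear_combination -he

open Classical in
theorem rank_succ (m v : ℕ) : rank X Y (m + 1) u v =
    rank X Y m u v + if slope X Y u m < slope X Y u v then 1 else 0 :=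
  Finset.sum_range_succ _ _

theorem rank_lt_rank {m v w : ℕ} (hv : v < m) (h : slope X Y u v < slope X Y u w) :
    rank X Y m u v < rank X Y m u w := by
  classical
  refine Finset.sum_lt_sum (fun r _ => ?_) ⟨v, Finset.mem_range.2 hv, ?_⟩
  · split_ifs with h1 h2
    · exact le_rfl
    · exact absurd (h1.trans h) h2
    · exact Nat.zero_le _
    · exact le_rfl
  · simp [h]

theorem rank_le (m v : ℕ) : rank X Y m u v ≤ m := by
  classical
  calc rank X Y m u v ≤ ∑ r ∈ Finset.range m, 1 :=
        Finset.sum_le_sum fun r _ => by split_ifs <;> omega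
    _ = m := by simp

theorem rank_lt {v : ℕ} (hv : v < N) : rank X Y N u v < N := by
  classical
  calc rank X Y N u v < ∑ r ∈ Finset.range N, 1 :=
        Finset.sum_lt_sum (fun r _ => by split_ifs <;> omega)
          ⟨v, Finset.mem_range.2 hv, by simp⟩
    _ = N := by simp

theorem GenPos.rank_injOn (hg : GenPos X Y N) (hu : u < N) {v w : ℕ} (hv : v < N) (hw : w < N)
    (h : rank X Y N u v = rank X Y N u w) : v = w := by
  by_contra hne
  rcases lt_or_gt_of_ne (hg.slope_ne hu hv hw hne) with h' | h'
  · exact (rank_lt_rank hv h').ne h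
  · exact (rank_lt_rank hw h').ne h.symm

theorem GenPos.exists_rank_eq (hg : GenPos X Y N) (hu : u < N) {k : ℕ} (hk : k < N) :
    ∃ v < N, rank X Y N u v = k := by
  have hs := Finset.surjOn_of_injOn_of_card_le (s := Finset.range N) (t := Finset.range N)
    (fun v => rank X Y N u v)
    (fun v hv => by simpa using rank_lt (by simpa using hv))
    (fun v hv w hw h => hg.rank_injOn hu (by simpa using hv) (by simpa using hw) h) le_rfl
  obtain ⟨v, hv, hv'⟩ := hs (by simpa using hk : k ∈ (Finset.range N : Set ℕ))
  exact ⟨v, by simpa using hv, hv'⟩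

theorem GenPos.slope_lt_of_rank_lt (hg : GenPos X Y N) (hu : u < N) {v w : ℕ} (hv : v < N)
    (hw : w < N) (h : rank X Y N u v < rank X Y N u w) : slope X Y u v < slope X Y u w := by
  rcases lt_or_gt_of_ne (hg.slope_ne hu hv hw (by rintro rfl; exact lt_irrefl _ h)) with h' | h'
  · exact h'
  · exact absurd (rank_lt_rank hw h') (not_lt.2 h.le)

theorem side_self (k : ℕ) : side X Y N u k u = 0 := by simp [side]

theorem side_rank_of_lt {v : ℕ} (h : X u < X v) : side X Y N u (rank X Y N u v) v = 1 := by
  simp [side, h]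

theorem side_rank_of_gt {v : ℕ} (h : X v < X u) : side X Y N u (rank X Y N u v) v = -1 := by
  simp [side, h, h.le]

theorem side_zero (r : ℕ) :
    side X Y N u 0 r = if X u < X r then 1 else if X r < X u then -1 else 0 := by
  simp [side]

theorem side_rank_add_one (v : ℕ) :
    side X Y N u (rank X Y N u v + 1) v = -side X Y N u (rank X Y N u v) v := by
  unfold side
  split_ifs <;> first | omega | norm_num

theorem side_add_one {k r : ℕ} (h : rank X Y N u r ≠ k) :
    side X Y N u (k + 1) r = side X Y N u k r := by
  unfold side
  split_ifs <;> first | omega | rfl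

/-- Passing the point `v` changes the cost only by the contribution of `v`. -/
theorem GenPos.sweepCost_add_one (hg : GenPos X Y N) (hu : u < N) {v : ℕ} (hv : v < N)
    (shape : Shape) (obj : Objective) (nb : ℕ) (F : ℕ → ℝ) (σ : ℝ) :
    sweepCost X Y shape obj nb N F u σ (rank X Y N u v + 1) +
      cost shape obj nb N v (F v) (σ * side X Y N u (rank X Y N u v) v) =
    sweepCost X Y shape obj nb N F u σ (rank X Y N u v) +
      cost shape obj nb N v (F v) (-(σ * side X Y N u (rank X Y N u v) v)) := by
  rw [← mul_neg, ← side_rank_add_one]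
  exact sum_add_eq_sum_add_of_eq_off (N := N) (v := v)
    (f := fun r => cost shape obj nb N r (F r) (σ * side X Y N u (rank X Y N u v + 1) r))
    (g := fun r => cost shape obj nb N r (F r) (σ * side X Y N u (rank X Y N u v) r)) hv
    fun r hr hrv => by rw [side_add_one fun h => hrv (hg.rank_injOn hu hr hv h)]

theorem orient_eq_slope {v r : ℕ} (hv : X v ≠ X u) (hr : X r ≠ X u) :
    orient X Y u v r = (X v - X u) * (X r - X u) * (slope X Y u r - slope X Y u v) := by
  have hv' := sub_ne_zero.2 hv
  have hr' := sub_ne_zero.2 hr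
  unfold orient slope
  field_simp

/-- When the turning line reaches `v`, it separates the other points as the line `u v` does, which
has the direction of the turning line if `v` is to the right of `u` and the opposite one
otherwise. -/
theorem GenPos.orient_side (hg : GenPos X Y N) (hu : u < N) {v r : ℕ} (hv : v < N) (hr : r < N)
    (huv : v ≠ u) (hrv : r ≠ v) :
    (0 < orient X Y u v r ↔
      0 < side X Y N u (rank X Y N u v) v * side X Y N u (rank X Y N u v) r) ∧
    (orient X Y u v r < 0 ↔
      side X Y N u (rank X Y N u v) v * side X Y N u (rank X Y N u v) r < 0) := by
  by_cases hru : r = u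
  · subst hru
    have : orient X Y r v r = 0 := by unfold orient; ring
    rw [side_self, this, mul_zero]
    simp
  have hxv := hg.x v hv u hu huv
  have hxr := hg.x r hr u hu hru
  rw [orient_eq_slope hxv hxr]
  have hrank : rank X Y N u r ≠ rank X Y N u v := fun h => hrv (hg.rank_injOn hu hr hv h)
  -- both products consist of factors of the same nonzero signs
  have key : ∀ a b c d : ℝ, 0 < a * c → 0 < b * d →
      ((0 < a * b ↔ 0 < c * d) ∧ (a * b < 0 ↔ c * d < 0)) := by
    intro a b c d h1 h2
    have h : 0 < a * b * (c * d) := by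
      have := mul_pos h1 h2
      linarith [mul_mul_mul_comm a c b d]
    rcases mul_pos_iff.1 h with ⟨h1, h2⟩ | ⟨h1, h2⟩
    · exact ⟨iff_of_true h1 h2, iff_of_false h1.not_gt h2.not_gt⟩
    · exact ⟨iff_of_false h1.not_gt h2.not_gt, iff_of_true h1 h2⟩
  rw [mul_assoc]
  refine key _ _ _ _ ?_ ?_
  · rcases lt_or_gt_of_ne hxv with h | h
    · rw [side_rank_of_gt h]; linarith
    · rw [side_rank_of_lt h]; linarith
  · rcases lt_or_gt_of_ne hrank with h' | h'
    · have hs := hg.slope_lt_of_rank_lt hu hr hv h'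
      rcases lt_or_gt_of_ne hxr with h | h
      · have : side X Y N u (rank X Y N u v) r = 1 := by simp [side, h, h.not_gt, h']
        rw [this]; nlinarith
      · have : side X Y N u (rank X Y N u v) r = -1 := by simp [side, h, h']
        rw [this]; nlinarith
    · have hs := hg.slope_lt_of_rank_lt hu hv hr h'
      rcases lt_or_gt_of_ne hxr with h | h
      · have : side X Y N u (rank X Y N u v) r = -1 := by simp [side, h, h.not_gt, h'.le]
        rw [this]; nlinarith
      · have : side X Y N u (rank X Y N u v) r = 1 := by simp [side, h, h'.le]
        rw [this]; nlinarith

/-- The cost of the line `u v` is read off from the turning line directed like it. -/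
theorem GenPos.totalCost_add (hg : GenPos X Y N) (hu : u < N) {v : ℕ} (hv : v < N) (huv : v ≠ u)
    (shape : Shape) (obj : Objective) (nb : ℕ) (F : ℕ → ℝ) :
    totalCost shape obj nb N F (orient X Y u v) + cost shape obj nb N v (F v) 1 =
    sweepCost X Y shape obj nb N F u (side X Y N u (rank X Y N u v) v) (rank X Y N u v) +
      cost shape obj nb N v (F v) 0 := by
  have h0 : orient X Y u v v = 0 := by unfold orient; ring
  have h1 : side X Y N u (rank X Y N u v) v * side X Y N u (rank X Y N u v) v = 1 := by
    rcases lt_or_gt_of_ne (hg.x v hv u hu huv) with h | h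
    · rw [side_rank_of_gt h]; norm_num
    · rw [side_rank_of_lt h]; norm_num
  have := sum_add_eq_sum_add_of_eq_off (N := N) (v := v)
    (f := fun r => cost shape obj nb N r (F r) (orient X Y u v r))
    (g := fun r => cost shape obj nb N r (F r)
      (side X Y N u (rank X Y N u v) v * side X Y N u (rank X Y N u v) r)) hv
    fun r hr hrv => cost_congr (hg.orient_side hu hv hr huv hrv).1
      (hg.orient_side hu hv hr huv hrv).2
  simp only [h0, h1] at this
  exact this

end

/-! ### Expressions and tests of the program -/

/-!
The arrays are used as follows.

* Real arrays: `0` and `1` hold the coordinates of all points, the blue ones first; `2` and `3`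
  those of the red points; `4` and `5` the output lines; `6` the amount of turning of the second
  line.
* Integer arrays: `0` holds the numbers of blue and of red points; `1` their sum; `2` the
  point `u` about which the second line turns; `3`, `4`, `14` loop counters; `5` a rank; `6` the
  points sorted by slope; `7` and `8` the points `p` and `q` on the first line; `9`, `10`, `11` the
  cost tables; `12` and `13` the costs for the two directions of the turning line; `15` the point
  `v` reached by it; `16` the cost of the current pair of lines; `17` the best cost so far and
  `18` to `21` the points `p`, `q`, `u`, `v` to which it belongs.
-/

/-- An integer variable: the first cell of an array. -/
abbrev scalar (a : ℕ) : NatExp := .read a (.const 0)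

/-- The first coordinate of a point. -/
abbrev xExp (i : NatExp) : RealExp := .read 0 i

/-- The second coordinate of a point. -/
abbrev yExp (i : NatExp) : RealExp := .read 1 i

/-- The expression computing `orient`. -/
def orientExp (p q r : NatExp) : RealExp :=
  .sub (.mul (.sub (xExp q) (xExp p)) (.sub (yExp r) (yExp p)))
    (.mul (.sub (yExp q) (yExp p)) (.sub (xExp r) (xExp p)))

/-- The expression computing `slope`. -/
def slopeExp (u r : NatExp) : RealExp :=
  .div (.sub (yExp r) (yExp u)) (.sub (xExp r) (xExp u))

/-- Disjunction of tests. -/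
def Test.or (b d : Test) : Test := .not (.and (.not b) (.not d))

/-- The test for `RedBad`. -/
def redTest (f g : RealExp) : Shape → Test
  | .wedge => .and (.realLt f (.const 0)) (.realLt g (.const 0))
  | .doubleWedge => .realLt (.const 0) (.mul f g)

/-- The test for `BlueBad`. -/
def blueTest (f g : RealExp) : Shape → Test
  | .wedge => .or (.realLt (.const 0) f) (.realLt (.const 0) g)
  | .doubleWedge => .realLt (.mul f g) (.const 0)

/-- The test whether a point is blue. -/
def isBlue (r : NatExp) : Test := .natLt r (.read 0 (.const 0))

/-- The test for `Bad`. -/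
def badTest (shape : Shape) (r : NatExp) (f g : RealExp) : Test :=
  .or (.and (isBlue r) (blueTest f g shape)) (.and (.not (isBlue r)) (redTest f g shape))

/-- The weight of blue outliers. -/
def blueWeight : Objective → NatExp
  | .red => .add (scalar 1) (.const 1)
  | _ => .const 1

/-- The weight of red outliers. -/
def redWeight : Objective → NatExp
  | .blue => .add (scalar 1) (.const 1)
  | _ => .const 1

/-- The memory holds the coordinates and the numbers of the points. -/
structure Ctx (X Y : ℕ → ℝ) (nb N : ℕ) (s : State) : Prop where
  x : s.real 0 = X
  y : s.real 1 = Y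
  blue : s.nat 0 0 = nb
  all : s.nat 1 0 = N

theorem Ctx.frame {X Y : ℕ → ℝ} {nb N : ℕ} {s s' : State} {L M : List ℕ} (h : Ctx X Y nb N s)
    (hf : Frame L M s s') (h0 : 0 ∉ L) (h1 : 1 ∉ L) (g0 : 0 ∉ M) (g1 : 1 ∉ M) : Ctx X Y nb N s' :=
  ⟨by rw [hf.real 0 g0, h.x], by rw [hf.real 1 g1, h.y], by rw [hf.nat 0 h0, h.blue],
    by rw [hf.nat 1 h1, h.all]⟩

theorem Ctx.setNat {X Y : ℕ → ℝ} {nb N : ℕ} {s : State} (h : Ctx X Y nb N s) {a : ℕ} (i v : ℕ)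
    (h0 : 1 < a) : Ctx X Y nb N (s.setNat a i v) := by
  refine ⟨h.x, h.y, ?_, ?_⟩
  · rw [State.setNat_nat, if_neg (by omega), h.blue]
  · rw [State.setNat_nat, if_neg (by omega), h.all]

section
variable {X Y : ℕ → ℝ} {nb N : ℕ} {s : State}

theorem Ctx.orientExp_eval (h : Ctx X Y nb N s) (p q r : NatExp) :
    (orientExp p q r).eval s = orient X Y (p.eval s) (q.eval s) (r.eval s) := by
  simp only [orientExp, RealExp.eval, h.x, h.y, orient]

theorem Ctx.slopeExp_eval (h : Ctx X Y nb N s) (u r : NatExp) :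
    (slopeExp u r).eval s = slope X Y (u.eval s) (r.eval s) := by
  simp only [slopeExp, RealExp.eval, h.x, h.y, slope]

theorem redTest_holds (f g : RealExp) (shape : Shape) :
    (redTest f g shape).Holds s ↔ RedBad shape (f.eval s) (g.eval s) := by
  cases shape <;> simp [redTest, Test.Holds, RedBad, RealExp.eval]

theorem blueTest_holds (f g : RealExp) (shape : Shape) :
    (blueTest f g shape).Holds s ↔ BlueBad shape (f.eval s) (g.eval s) := by
  cases shape
  · simp only [blueTest, Test.or, Test.Holds, BlueBad, RealExp.eval, Int.cast_zero]
    tauto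
  · simp [blueTest, Test.Holds, BlueBad, RealExp.eval]

theorem Ctx.isBlue_holds (h : Ctx X Y nb N s) (r : NatExp) :
    (isBlue r).Holds s ↔ r.eval s < nb := by
  simp only [isBlue, Test.Holds, NatExp.eval, h.blue]

theorem Ctx.badTest_holds (h : Ctx X Y nb N s) (shape : Shape) (r : NatExp) (f g : RealExp) :
    (badTest shape r f g).Holds s ↔ Bad shape (r.eval s < nb) (f.eval s) (g.eval s) := by
  simp only [badTest, Test.or, Test.Holds, h.isBlue_holds, redTest_holds, blueTest_holds, Bad]
  tauto

/-- Store the cost of the `r`-th point in the `r`-th cell of the integer array `a`. -/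
def storeCost (shape : Shape) (obj : Objective) (a : ℕ) (r : NatExp) (f g : RealExp) : Prog :=
  .ite (badTest shape r f g)
    (.ite (isBlue r) (.natSet a r (blueWeight obj)) (.natSet a r (redWeight obj)))
    (.natSet a r (.const 0))

theorem Ctx.runs_storeCost {T W : ℕ} (h : Ctx X Y nb N s) (hW : N + 1 ≤ W) {shape : Shape}
    {obj : Objective} {a : ℕ} {r : NatExp} {f g : RealExp} {Q : State → Prop}
    (hQ : Q (s.setNat a (r.eval s) (cost shape obj nb N (r.eval s) (f.eval s) (g.eval s)))) :
    Runs T W (storeCost shape obj a r f g) s Q := by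
  refine .ite (fun hb => .ite (fun hc => .natSet ?_ ?_) fun hc => .natSet ?_ ?_)
    fun hb => .natSet (Nat.zero_le _) ?_
  all_goals rw [h.badTest_holds] at hb
  all_goals simp only [cost, hb, if_true, if_false] at hQ
  · rw [h.isBlue_holds] at hc
    cases obj <;> simp [blueWeight, NatExp.eval, h.all] <;> omega
  · rw [h.isBlue_holds] at hc
    convert hQ using 2
    cases obj <;> simp [blueWeight, NatExp.eval, h.all, weight, hc]
  · rw [h.isBlue_holds] at hc
    cases obj <;> simp [redWeight, NatExp.eval, h.all] <;> omega
  · rw [h.isBlue_holds] at hc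
    convert hQ using 2
    cases obj <;> simp [redWeight, NatExp.eval, h.all, weight, hc]
  · exact hQ

end

/-! ### Sorting the points by slope -/

/-- Compute, in the integer array `6`, the points in the order of their slopes at the point stored
in the variable `2`. -/
def sortBySlope : Prog :=
  forLoop 3 1 0 (.seq (.natSet 5 (.const 0) (.const 0)) (.seq
    (forLoop 4 1 0 (.ite (.realLt (slopeExp (scalar 2) (scalar 4)) (slopeExp (scalar 2) (scalar 3)))
      (.natSet 5 (.const 0) (.add (scalar 5) (.const 1))) .skip))
    (.natSet 6 (scalar 5) (scalar 3))))

@[simp] theorem sortBySlope_natMods : sortBySlope.natMods = [3, 5, 4, 5, 4, 6, 3] := rfl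

@[simp] theorem sortBySlope_realMods : sortBySlope.realMods = [] := rfl

theorem GenPos.runs_sortBySlope {X Y : ℕ → ℝ} {nb N W u : ℕ} {s : State} (hg : GenPos X Y N)
    (hs : Ctx X Y nb N s) (hu : u < N) (hsu : s.nat 2 0 = u) (hW : N + 1 ≤ W) :
    Runs N W sortBySlope s fun s' => ∀ v < N, s'.nat 6 (rank X Y N u v) = v := by
  refine .forLoop (fun m s' => ∀ v < m, s'.nat 6 (rank X Y N u v) = v) hs.all le_rfl (by omega)
    (by decide) (by decide) (fun k s v h => by simpa using h) (by simp) ?_ fun s₁ _ _ h => h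
  intro v hv s₁ hf hi hinv
  have hs₁ : Ctx X Y nb N s₁ := hs.frame hf (by decide) (by decide) (by decide) (by decide)
  have hu₁ : s₁.nat 2 0 = u := by rw [hf.nat 2 (by decide), hsu]
  refine .seq (.natSet (Nat.zero_le _) (.seq ?_))
  refine .forLoop (fun m s' => s'.nat 5 0 = rank X Y m u v) (m := N) (by simpa using hs₁.all)
    le_rfl (by omega) (by decide) (by decide) (fun k s v h => by simpa using h)
    (by simp [rank, NatExp.eval]) ?_ ?_
  · intro r hr s₂ hf₂ hr₂ h₂
    have hs₂ : Ctx X Y nb N s₂ := (hs₁.setNat _ _ (by omega)).frame hf₂ (by decide) (by decide)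
      (by decide) (by decide)
    have hu₂ : s₂.nat 2 0 = u := by rw [hf₂.nat 2 (by decide)]; simpa using hu₁
    have hv₂ : s₂.nat 3 0 = v := by rw [hf₂.nat 3 (by decide)]; simpa using hi
    have hrk := rank_le (X := X) (Y := Y) (u := u) r v
    refine .ite (fun hb => .natSet ?_ ?_) fun hb => .skip ?_
    all_goals
      simp only [Test.Holds, hs₂.slopeExp_eval, NatExp.eval, hu₂, hv₂, hr₂] at hb
      try simp only [NatExp.eval, h₂]
    · omega
    · simp [rank_succ, hb]
    · simp [rank_succ, hb]
  · intro s₂ hf₂ hr₂ h₂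
    have hv₂ : s₂.nat 3 0 = v := by rw [hf₂.nat 3 (by decide)]; simpa using hi
    have h6 : s₂.nat 6 = s₁.nat 6 := by rw [hf₂.nat 6 (by decide)]; simp
    refine .natSet (by simp only [NatExp.eval, hv₂]; omega) fun w hw => ?_
    simp only [NatExp.eval, hv₂, h₂, State.setNat_nat, if_true, h6]
    by_cases hwv : w = v
    · rw [hwv, Function.update_self]
    · rw [Function.update_of_ne fun h => hwv (hg.rank_injOn hu (by omega) hv h), hinv w (by omega)]

/-! ### Cost tables -/

/-- The value of the first affine function at the point in the variable `4`. -/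
def firstExp : RealExp := orientExp (scalar 7) (scalar 8) (scalar 4)

/-- For the line through the points in the variables `7` and `8`, compute the costs of all points
on the positive side of, on, and on the negative side of the second line, and the costs at the
start of the turn about the point in the variable `2`, where the second line is almost vertical. -/
def costTables (shape : Shape) (obj : Objective) : Prog :=
  .seq (.natSet 12 (.const 0) (.const 0)) (.seq (.natSet 13 (.const 0) (.const 0))
    (forLoop 4 1 0 (.seq (storeCost shape obj 9 (scalar 4) firstExp (.const 1))
      (.seq (storeCost shape obj 10 (scalar 4) firstExp (.const 0))
      (.seq (storeCost shape obj 11 (scalar 4) firstExp (.const (-1)))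
      (.ite (.realLt (xExp (scalar 2)) (xExp (scalar 4)))
        (.seq (.natSet 12 (.const 0) (.add (scalar 12) (.read 9 (scalar 4))))
          (.natSet 13 (.const 0) (.add (scalar 13) (.read 11 (scalar 4)))))
        (.ite (.realLt (xExp (scalar 4)) (xExp (scalar 2)))
          (.seq (.natSet 12 (.const 0) (.add (scalar 12) (.read 11 (scalar 4))))
            (.natSet 13 (.const 0) (.add (scalar 13) (.read 9 (scalar 4)))))
          (.seq (.natSet 12 (.const 0) (.add (scalar 12) (.read 10 (scalar 4))))
            (.natSet 13 (.const 0) (.add (scalar 13) (.read 10 (scalar 4))))))))))))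

@[simp] theorem costTables_natMods (shape : Shape) (obj : Objective) :
    (costTables shape obj).natMods = [12, 13, 4, 9, 9, 9, 10, 10, 10, 11, 11, 11, 12, 13, 12, 13,
      12, 13, 4] := rfl

@[simp] theorem costTables_realMods (shape : Shape) (obj : Objective) :
    (costTables shape obj).realMods = [] := rfl

/-- The cost tables of the affine function `F` for the first `m` points. -/
structure Tables (shape : Shape) (obj : Objective) (nb N : ℕ) (F : ℕ → ℝ) (m : ℕ) (s : State) :
    Prop where
  pos : ∀ r < m, s.nat 9 r = cost shape obj nb N r (F r) 1
  zero : ∀ r < m, s.nat 10 r = cost shape obj nb N r (F r) 0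
  neg : ∀ r < m, s.nat 11 r = cost shape obj nb N r (F r) (-1)

theorem Tables.congr {shape : Shape} {obj : Objective} {nb N : ℕ} {F : ℕ → ℝ} {m : ℕ}
    {s s' : State} (h : Tables shape obj nb N F m s) (h9 : s'.nat 9 = s.nat 9)
    (h10 : s'.nat 10 = s.nat 10) (h11 : s'.nat 11 = s.nat 11) : Tables shape obj nb N F m s' :=
  ⟨by rw [h9]; exact h.pos, by rw [h10]; exact h.zero, by rw [h11]; exact h.neg⟩

theorem sum_cost_le {shape : Shape} {obj : Objective} {nb N W : ℕ} (hW : (N + 1) * (N + 1) ≤ W)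
    {m : ℕ} (hm : m ≤ N) (F G : ℕ → ℝ) :
    ∑ r ∈ Finset.range m, cost shape obj nb N r (F r) (G r) ≤ W := by
  calc _ ≤ ∑ r ∈ Finset.range m, (N + 1) := Finset.sum_le_sum fun r _ => cost_le r _ _
    _ = m * (N + 1) := by simp
    _ ≤ (N + 1) * (N + 1) := Nat.mul_le_mul_right _ (by omega)
    _ ≤ W := hW

theorem Ctx.runs_costTables {X Y : ℕ → ℝ} {nb N W p q u : ℕ} {s : State} {shape : Shape}
    {obj : Objective} (hs : Ctx X Y nb N s) (hsu : s.nat 2 0 = u) (hsp : s.nat 7 0 = p)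
    (hsq : s.nat 8 0 = q) (hW : (N + 1) * (N + 1) ≤ W) :
    Runs N W (costTables shape obj) s fun s' =>
      Tables shape obj nb N (orient X Y p q) N s' ∧
      s'.nat 12 0 = sweepCost X Y shape obj nb N (orient X Y p q) u 1 0 ∧
      s'.nat 13 0 = sweepCost X Y shape obj nb N (orient X Y p q) u (-1) 0 := by
  have hW' : N + 1 ≤ W := le_trans (Nat.le_mul_of_pos_left _ (by omega)) hW
  refine .seq (.natSet (Nat.zero_le _) (.seq (.natSet (Nat.zero_le _) ?_)))
  refine .forLoop (fun m s' => Tables shape obj nb N (orient X Y p q) m s' ∧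
    s'.nat 12 0 = ∑ r ∈ Finset.range m,
      cost shape obj nb N r (orient X Y p q r) (1 * side X Y N u 0 r) ∧
    s'.nat 13 0 = ∑ r ∈ Finset.range m,
      cost shape obj nb N r (orient X Y p q r) (-1 * side X Y N u 0 r)) (m := N)
    (by simpa using hs.all) le_rfl (by omega) (by simp [Prog.natMods, storeCost])
    (by simp [Prog.natMods, storeCost])
    (fun k s v h => ⟨h.1.congr (by simp) (by simp) (by simp), by simpa using h.2⟩)
    ⟨⟨by simp, by simp, by simp⟩, by simp [NatExp.eval], by simp [NatExp.eval]⟩ ?_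
    fun s₁ _ _ h => h
  rintro r hr s₁ hf hr₁ ⟨ht, h12, h13⟩
  have hs₁ : Ctx X Y nb N s₁ := ((hs.setNat _ _ (by omega)).setNat _ _ (by omega)).frame hf
    (by simp [Prog.natMods, storeCost]) (by simp [Prog.natMods, storeCost])
    (by simp [Prog.realMods, storeCost]) (by simp [Prog.realMods, storeCost])
  have hu₁ : s₁.nat 2 0 = u := by
    rw [hf.nat 2 (by simp [Prog.natMods, storeCost])]; simpa using hsu
  have hp₁ : s₁.nat 7 0 = p := by
    rw [hf.nat 7 (by simp [Prog.natMods, storeCost])]; simpa using hsp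
  have hq₁ : s₁.nat 8 0 = q := by
    rw [hf.nat 8 (by simp [Prog.natMods, storeCost])]; simpa using hsq
  set F := orient X Y p q with hF
  refine .seq (hs₁.runs_storeCost hW' (.seq ((hs₁.setNat _ _ (by omega)).runs_storeCost hW' (.seq
    (((hs₁.setNat _ _ (by omega)).setNat _ _ (by omega)).runs_storeCost hW' ?_)))))
  -- `s₂`, `s₃`, `s₄` are the states after the entries of the three tables have been written
  have e₁ : (firstExp).eval s₁ = F r := by
    rw [firstExp, hs₁.orientExp_eval]; simp only [NatExp.eval, hp₁, hq₁, hr₁, hF]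
  set s₂ := s₁.setNat 9 ((scalar 4).eval s₁)
    (cost shape obj nb N ((scalar 4).eval s₁) (firstExp.eval s₁) ((RealExp.const 1).eval s₁))
    with h₂
  have e₂ : (firstExp).eval s₂ = F r := by
    rw [firstExp, (hs₁.setNat _ _ (by omega)).orientExp_eval]
    simp [NatExp.eval, hp₁, hq₁, hr₁, hF]
  set s₃ := s₂.setNat 10 ((scalar 4).eval s₂)
    (cost shape obj nb N ((scalar 4).eval s₂) (firstExp.eval s₂) ((RealExp.const 0).eval s₂))
    with h₃
  have e₃ : (firstExp).eval s₃ = F r := by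
    rw [firstExp, ((hs₁.setNat _ _ (by omega)).setNat _ _ (by omega)).orientExp_eval]
    simp [NatExp.eval, hp₁, hq₁, hr₁, hF, h₂]
  set s₄ := s₃.setNat 11 ((scalar 4).eval s₃)
    (cost shape obj nb N ((scalar 4).eval s₃) (firstExp.eval s₃) ((RealExp.const (-1)).eval s₃))
    with h₄
  have hr₂ : (scalar 4).eval s₂ = r := by simp [NatExp.eval, h₂, hr₁]
  have hr₃ : (scalar 4).eval s₃ = r := by simp [NatExp.eval, h₃, h₂, hr₁]
  have hr₄ : s₄.nat 4 0 = r := by simp [h₄, h₃, h₂, hr₁]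
  have hr₁' : (scalar 4).eval s₁ = r := hr₁
  rw [hr₁', e₁] at h₂
  rw [hr₂, e₂] at h₃
  rw [hr₃, e₃] at h₄
  have hu₄ : s₄.nat 2 0 = u := by simp [h₄, h₃, h₂, hu₁]
  have hx₄ : s₄.real 0 = X := by simp [h₄, h₃, h₂, hs₁.x]
  have ht₄ : Tables shape obj nb N F (r + 1) s₄ := by
    refine ⟨fun w hw => ?_, fun w hw => ?_, fun w hw => ?_⟩
    · by_cases hwr : w = r
      · subst hwr; simp [h₄, h₃, h₂, RealExp.eval]
      · simp [h₄, h₃, h₂, Function.update_of_ne hwr, ht.pos w (by omega)]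
    · by_cases hwr : w = r
      · subst hwr; simp [h₄, h₃, RealExp.eval]
      · simp [h₄, h₃, h₂, Function.update_of_ne hwr, ht.zero w (by omega)]
    · by_cases hwr : w = r
      · subst hwr; simp [h₄, RealExp.eval]
      · simp [h₄, h₃, h₂, Function.update_of_ne hwr, ht.neg w (by omega)]
  have h12₄ : s₄.nat 12 0 = _ := (by simp [h₄, h₃, h₂] : s₄.nat 12 0 = s₁.nat 12 0).trans h12
  have h13₄ : s₄.nat 13 0 = _ := (by simp [h₄, h₃, h₂] : s₄.nat 13 0 = s₁.nat 13 0).trans h13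
  have h9₄ := ht₄.pos r (by omega)
  have h10₄ := ht₄.zero r (by omega)
  have h11₄ := ht₄.neg r (by omega)
  have hb₁ := sum_cost_le (shape := shape) (obj := obj) (nb := nb) hW (m := r + 1) (by omega) F
    (fun r => 1 * side X Y N u 0 r)
  have hb₂ := sum_cost_le (shape := shape) (obj := obj) (nb := nb) hW (m := r + 1) (by omega) F
    (fun r => -1 * side X Y N u 0 r)
  rw [Finset.sum_range_succ] at hb₁ hb₂
  clear_value s₄
  -- the three cases: `r` is to the right of `u`, to the left, or `u` itself
  have fin : ∀ a b : ℕ, s₄.nat a r = cost shape obj nb N r (F r) (1 * side X Y N u 0 r) →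
      s₄.nat b r = cost shape obj nb N r (F r) (-1 * side X Y N u 0 r) → b ≠ 12 →
      Runs N W (.seq (.natSet 12 (.const 0) (.add (scalar 12) (.read a (scalar 4))))
        (.natSet 13 (.const 0) (.add (scalar 13) (.read b (scalar 4))))) s₄ fun s' =>
      Tables shape obj nb N F (r + 1) s' ∧
      s'.nat 12 0 = ∑ r ∈ Finset.range (r + 1),
        cost shape obj nb N r (F r) (1 * side X Y N u 0 r) ∧
      s'.nat 13 0 = ∑ r ∈ Finset.range (r + 1),
        cost shape obj nb N r (F r) (-1 * side X Y N u 0 r) := by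
    intro a b ha hb hb12
    refine .seq (.natSet ?_ (.natSet ?_ ⟨ht₄.congr ?_ ?_ ?_, ?_, ?_⟩))
    · simpa only [NatExp.eval, hr₄, ha, h12₄] using hb₁
    · simpa [NatExp.eval, hr₄, ha, hb, h12₄, h13₄, hb12] using hb₂
    · simp
    · simp
    · simp
    · simp [NatExp.eval, hr₄, ha, h12₄, Finset.sum_range_succ]
    · simp [NatExp.eval, hr₄, ha, hb, h12₄, h13₄, hb12, Finset.sum_range_succ]
  refine .ite (fun hb => fin 9 11 ?_ ?_ (by decide)) fun hb => .ite
    (fun hb' => fin 11 9 ?_ ?_ (by decide)) fun hb' => fin 10 10 ?_ ?_ (by decide)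
  all_goals
    simp only [Test.Holds, RealExp.eval, NatExp.eval, hx₄, hu₄, hr₄] at hb
    try simp only [Test.Holds, RealExp.eval, NatExp.eval, hx₄, hu₄, hr₄] at hb'
  · rw [h9₄, side_zero, if_pos hb, mul_one]
  · rw [h11₄, side_zero, if_pos hb, mul_one]
  · rw [h11₄, side_zero, if_neg hb, if_pos hb', one_mul]
  · rw [h9₄, side_zero, if_neg hb, if_pos hb', neg_mul_neg, mul_one]
  · rw [h10₄, side_zero, if_neg hb, if_neg hb', mul_zero]
  · rw [h10₄, side_zero, if_neg hb, if_neg hb', mul_zero]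

/-! ### The search -/

/-- Replace the best pair of lines found so far by the current one if that is cheaper. -/
def keepBest : Prog :=
  .ite (.natLt (scalar 16) (scalar 17))
    (.seq (.natSet 17 (.const 0) (scalar 16)) (.seq (.natSet 18 (.const 0) (scalar 7))
      (.seq (.natSet 19 (.const 0) (scalar 8)) (.seq (.natSet 20 (.const 0) (scalar 2))
        (.natSet 21 (.const 0) (scalar 15)))))) .skip

@[simp] theorem keepBest_natMods : keepBest.natMods = [17, 18, 19, 20, 21] := rfl

@[simp] theorem keepBest_realMods : keepBest.realMods = [] := rfl

/-- The turning line passes the point in the variable `15`. The variable `a` holds the cost for the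
direction in which this point is on the positive side before it is passed, the variable `b` that
for the other direction. -/
def sweepStep (a b : ℕ) : Prog :=
  .seq (.natSet 16 (.const 0) (.sub (.add (scalar a) (.read 10 (scalar 15))) (.read 9 (scalar 15))))
    (.seq (.natSet a (.const 0)
        (.sub (.add (scalar a) (.read 11 (scalar 15))) (.read 9 (scalar 15))))
      (.seq (.natSet b (.const 0)
        (.sub (.add (scalar b) (.read 9 (scalar 15))) (.read 11 (scalar 15)))) keepBest))

/-- Turn the second line about the point in the variable `2` through all the other points. -/
def sweep : Prog :=
  forLoop 14 1 0 (.seq (.natSet 15 (.const 0) (.read 6 (scalar 14)))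
    (.ite (.realLt (xExp (scalar 2)) (xExp (scalar 15))) (sweepStep 12 13)
      (.ite (.realLt (xExp (scalar 15)) (xExp (scalar 2))) (sweepStep 13 12) .skip)))

@[simp] theorem sweep_natMods : sweep.natMods = [14, 15, 16, 12, 13, 17, 18, 19, 20, 21,
    16, 13, 12, 17, 18, 19, 20, 21, 14] := rfl

@[simp] theorem sweep_realMods : sweep.realMods = [] := rfl

/-- Examine all pairs of lines through two points each. -/
def search (shape : Shape) (obj : Objective) : Prog :=
  forLoop 2 1 0 (.seq sortBySlope (forLoop 7 1 0 (forLoop 8 1 0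
    (.ite (.or (.natLt (scalar 7) (scalar 8)) (.natLt (scalar 8) (scalar 7)))
      (.seq (costTables shape obj) sweep) .skip))))

/-- `p`, `q`, `u`, `v` determine two lines, which need not cross. -/
structure IsPair (N p q u v : ℕ) : Prop where
  lt_p : p < N
  lt_q : q < N
  ne_pq : p ≠ q
  lt_u : u < N
  lt_v : v < N
  ne_vu : v ≠ u

/-- The pair of lines stored in the variables `18` to `21` with its cost in the variable `17` is the
best one among those in `V`; or the initial value, larger than all costs, has not been replaced. -/
structure Best (X Y : ℕ → ℝ) (shape : Shape) (obj : Objective) (nb N : ℕ)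
    (V : ℕ → ℕ → ℕ → ℕ → Prop) (s : State) : Prop where
  le : ∀ p q u v, IsPair N p q u v → V p q u v →
    s.nat 17 0 ≤ totalCost shape obj nb N (orient X Y p q) (orient X Y u v)
  eq : s.nat 17 0 = (N + 1) * (N + 1) ∨
    (IsPair N (s.nat 18 0) (s.nat 19 0) (s.nat 20 0) (s.nat 21 0) ∧
    s.nat 17 0 = totalCost shape obj nb N (orient X Y (s.nat 18 0) (s.nat 19 0))
      (orient X Y (s.nat 20 0) (s.nat 21 0)))

section
variable {X Y : ℕ → ℝ} {shape : Shape} {obj : Objective} {nb N W T : ℕ}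
  {V V' : ℕ → ℕ → ℕ → ℕ → Prop} {s s' : State}

theorem Best.mono (h : Best X Y shape obj nb N V s)
    (hV : ∀ p q u v, IsPair N p q u v → V' p q u v → V p q u v) :
    Best X Y shape obj nb N V' s :=
  ⟨fun p q u v hp hv => h.le p q u v hp (hV p q u v hp hv), h.eq⟩

theorem Best.congr (h : Best X Y shape obj nb N V s)
    (h' : ∀ a ∈ [17, 18, 19, 20, 21], s'.nat a = s.nat a) : Best X Y shape obj nb N V s' := by
  obtain ⟨h1, h2⟩ := h
  rw [← h' 17 (by decide), ← h' 18 (by decide), ← h' 19 (by decide), ← h' 20 (by decide),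
    ← h' 21 (by decide)] at h2
  exact ⟨by rw [h' 17 (by decide)]; exact h1, h2⟩

theorem Best.setNat (h : Best X Y shape obj nb N V s) {a : ℕ} (i v : ℕ)
    (ha : a ∉ [17, 18, 19, 20, 21]) : Best X Y shape obj nb N V (s.setNat a i v) :=
  h.congr fun b hb => by rw [State.setNat_nat, if_neg]; rintro rfl; exact ha hb

theorem Best.frame (h : Best X Y shape obj nb N V s) {L M : List ℕ} (hf : Frame L M s s')
    (hL : ∀ a ∈ [17, 18, 19, 20, 21], a ∉ L) : Best X Y shape obj nb N V s' :=
  h.congr fun b hb => hf.nat b (hL b hb)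

theorem Best.runs_keepBest {p q u v : ℕ} (h : Best X Y shape obj nb N V s) (hN : N ≤ W)
    (hW : (N + 1) * (N + 1) ≤ W) (hp : s.nat 7 0 = p) (hq : s.nat 8 0 = q) (hu : s.nat 2 0 = u)
    (hv : s.nat 15 0 = v) (hpair : IsPair N p q u v)
    (hc : s.nat 16 0 = totalCost shape obj nb N (orient X Y p q) (orient X Y u v))
    (hV : ∀ p' q' u' v', IsPair N p' q' u' v' → V' p' q' u' v' →
      V p' q' u' v' ∨ (p' = p ∧ q' = q ∧ u' = u ∧ v' = v)) :
    Runs T W keepBest s (Best X Y shape obj nb N V') := by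
  have hcW : s.nat 16 0 ≤ W := by
    rw [hc]
    exact (totalCost_le _ _).trans ((Nat.mul_le_mul_right _ (by omega)).trans hW)
  have hpW := hpair.lt_p
  have hqW := hpair.lt_q
  have huW := hpair.lt_u
  have hvW := hpair.lt_v
  refine .ite (fun hb => ?_) fun hb => .skip ?_
  · have hb' : s.nat 16 0 < s.nat 17 0 := hb
    refine .seq (.natSet (by simpa [NatExp.eval] using hcW) (.seq (.natSet ?_ (.seq (.natSet ?_
      (.seq (.natSet ?_ (.natSet ?_ ⟨?_, ?_⟩))))))))
    · simp [NatExp.eval, hp]; omega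
    · simp [NatExp.eval, hq]; omega
    · simp [NatExp.eval, hu]; omega
    · simp [NatExp.eval, hv]; omega
    · intro p' q' u' v' h1 h2
      simp only [NatExp.eval, State.setNat_nat]
      simp only [Nat.reduceEqDiff, if_false, if_true, Function.update_self]
      rcases hV p' q' u' v' h1 h2 with h3 | ⟨rfl, rfl, rfl, rfl⟩
      · exact hb'.le.trans (h.le _ _ _ _ h1 h3)
      · exact hc.le
    · right
      simpa [NatExp.eval, hp, hq, hu, hv] using ⟨hpair, hc⟩
  · have hb' : s.nat 17 0 ≤ s.nat 16 0 := not_lt.1 hb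
    refine ⟨fun p' q' u' v' h1 h2 => ?_, h.eq⟩
    rcases hV p' q' u' v' h1 h2 with h3 | ⟨rfl, rfl, rfl, rfl⟩
    · exact h.le _ _ _ _ h1 h3
    · exact hb'.trans hc.le

theorem sweepCost_le (hW : (N + 1) * (N + 1) ≤ W) (F : ℕ → ℝ) (u : ℕ) (σ : ℝ) (k : ℕ) :
    sweepCost X Y shape obj nb N F u σ k ≤ W :=
  sum_cost_le hW le_rfl _ _

/-- Passing `v` examines the pair with the second line `u v` and updates both costs of the turning
line. Truncated subtraction does no harm, as the subtracted terms are contained in the sums. -/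
theorem GenPos.runs_sweepStep (hg : GenPos X Y N) {p q u v a b : ℕ}
    (hpair : IsPair N p q u v) (hW : (N + 1) * (N + 1) ≤ W)
    (hp : s.nat 7 0 = p) (hq : s.nat 8 0 = q) (hu : s.nat 2 0 = u) (hv : s.nat 15 0 = v)
    (ht : Tables shape obj nb N (orient X Y p q) N s) (hB : Best X Y shape obj nb N V s)
    (hab : a = 12 ∧ b = 13 ∨ a = 13 ∧ b = 12) {σ τ : ℝ}
    (hσ : σ * side X Y N u (rank X Y N u v) v = 1) (hτ : τ * side X Y N u (rank X Y N u v) v = -1)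
    (hσ' : σ = side X Y N u (rank X Y N u v) v)
    (ha : s.nat a 0 = sweepCost X Y shape obj nb N (orient X Y p q) u σ (rank X Y N u v))
    (hb : s.nat b 0 = sweepCost X Y shape obj nb N (orient X Y p q) u τ (rank X Y N u v))
    (hV : ∀ p' q' u' v', IsPair N p' q' u' v' → V' p' q' u' v' →
      V p' q' u' v' ∨ (p' = p ∧ q' = q ∧ u' = u ∧ v' = v)) :
    Runs T W (sweepStep a b) s fun s' =>
      s'.nat a 0 = sweepCost X Y shape obj nb N (orient X Y p q) u σ (rank X Y N u v + 1) ∧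
      s'.nat b 0 = sweepCost X Y shape obj nb N (orient X Y p q) u τ (rank X Y N u v + 1) ∧
      Best X Y shape obj nb N V' s' := by
  have hN : N ≤ W := by nlinarith
  have c₁ := ht.pos v hpair.lt_v
  have c₀ := ht.zero v hpair.lt_v
  have c₂ := ht.neg v hpair.lt_v
  have e₀ := hg.totalCost_add hpair.lt_u hpair.lt_v hpair.ne_vu shape obj nb (orient X Y p q)
  have e₁ := hg.sweepCost_add_one hpair.lt_u hpair.lt_v shape obj nb (orient X Y p q) σ
  have e₂ := hg.sweepCost_add_one hpair.lt_u hpair.lt_v shape obj nb (orient X Y p q) τ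
  rw [hσ] at e₁
  rw [hτ, neg_neg] at e₂
  rw [← hσ', ← ha, ← c₀, ← c₁] at e₀
  rw [← ha, ← c₁, ← c₂] at e₁
  rw [← hb, ← c₁, ← c₂] at e₂
  have w₀ := (totalCost_le (shape := shape) (obj := obj) (nb := nb) (N := N) (orient X Y p q)
    (orient X Y u v)).trans ((Nat.mul_le_mul_right _ (by omega)).trans hW)
  have w₁ := sweepCost_le (X := X) (Y := Y) (shape := shape) (obj := obj) (nb := nb) hW
    (orient X Y p q) u σ (rank X Y N u v + 1)
  have w₂ := sweepCost_le (X := X) (Y := Y) (shape := shape) (obj := obj) (nb := nb) hW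
    (orient X Y p q) u τ (rank X Y N u v + 1)
  have main : Runs T W (sweepStep a b) s fun s' =>
      (s'.nat a 0 = sweepCost X Y shape obj nb N (orient X Y p q) u σ (rank X Y N u v + 1) ∧
      s'.nat b 0 = sweepCost X Y shape obj nb N (orient X Y p q) u τ (rank X Y N u v + 1)) ∧
      Best X Y shape obj nb N V' s' := by
    rcases hab with ⟨rfl, rfl⟩ | ⟨rfl, rfl⟩
    all_goals
      refine .seq (.natSet ?_ (.seq (.natSet ?_ (.seq (.natSet ?_ ?_)))))
      · simp [NatExp.eval, hv]; omega
      · simp [NatExp.eval, hv]; omega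
      · simp [NatExp.eval, hv]; omega
      refine ((((hB.setNat _ _ (by decide)).setNat _ _ (by decide)).setNat _ _
        (by decide)).runs_keepBest hN hW (by simpa using hp) (by simpa using hq) (by simpa using hu)
        (by simpa using hv) hpair ?_ hV).frame.mono ?_
      · simp [NatExp.eval, hv]; omega
      · rintro s' ⟨hf, hB'⟩
        refine ⟨?_, hB'⟩
        rw [hf.nat 12 (by decide), hf.nat 13 (by decide)]
        constructor
        · simp [NatExp.eval, hv]; omega
        · simp [NatExp.eval, hv]; omega
  exact main.mono fun s' h => ⟨h.1.1, h.1.2, h.2⟩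

/-- The sweep examines all pairs with the given `p`, `q` and `u`. -/
theorem GenPos.runs_sweep (hg : GenPos X Y N) {p q u : ℕ} (hs : Ctx X Y nb N s)
    (hpN : p < N) (hqN : q < N) (hpq : p ≠ q) (huN : u < N) (hW : (N + 1) * (N + 1) ≤ W)
    (hp : s.nat 7 0 = p) (hq : s.nat 8 0 = q) (hu : s.nat 2 0 = u)
    (hord : ∀ v < N, s.nat 6 (rank X Y N u v) = v)
    (ht : Tables shape obj nb N (orient X Y p q) N s) (hB : Best X Y shape obj nb N V s)
    (h12 : s.nat 12 0 = sweepCost X Y shape obj nb N (orient X Y p q) u 1 0)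
    (h13 : s.nat 13 0 = sweepCost X Y shape obj nb N (orient X Y p q) u (-1) 0) :
    Runs N W sweep s (Best X Y shape obj nb N
      fun p' q' u' v' => V p' q' u' v' ∨ (p' = p ∧ q' = q ∧ u' = u)) := by
  have hN : N ≤ W := by nlinarith
  refine .forLoop (fun k s' =>
    s'.nat 12 0 = sweepCost X Y shape obj nb N (orient X Y p q) u 1 k ∧
    s'.nat 13 0 = sweepCost X Y shape obj nb N (orient X Y p q) u (-1) k ∧
    Best X Y shape obj nb N (fun p' q' u' v' => V p' q' u' v' ∨
      (p' = p ∧ q' = q ∧ u' = u ∧ rank X Y N u v' < k)) s') hs.all le_rfl hN (by decide) (by decide)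
    ?_ ⟨h12, h13, hB.mono fun p' q' u' v' _ h => ?_⟩ ?_ ?_
  · rintro k s v ⟨h1, h2, h3⟩
    exact ⟨by simpa using h1, by simpa using h2, h3.setNat _ _ (by decide)⟩
  · rcases h with h | ⟨-, -, -, h⟩
    · exact h
    · omega
  · rintro k hk s₁ hf hk₁ ⟨h12, h13, hB₁⟩
    obtain ⟨v, hv, rfl⟩ := hg.exists_rank_eq huN hk
    have hv₁ : s₁.nat 6 (s₁.nat 14 0) = v := by rw [hk₁, hf.nat 6 (by decide), hord v hv]
    have hu₁ : s₁.nat 2 0 = u := by rw [hf.nat 2 (by decide), hu]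
    have hp₁ : s₁.nat 7 0 = p := by rw [hf.nat 7 (by decide), hp]
    have hq₁ : s₁.nat 8 0 = q := by rw [hf.nat 8 (by decide), hq]
    have hx₁ : s₁.real 0 = X := by rw [hf.real 0 (by decide), hs.x]
    have ht₁ := ht.congr (hf.nat 9 (by decide)) (hf.nat 10 (by decide)) (hf.nat 11 (by decide))
    have hB₂ := hB₁.setNat (a := 15) 0 v (by decide)
    have ht₂ : Tables shape obj nb N (orient X Y p q) N (s₁.setNat 15 0 v) :=
      ht₁.congr (by simp) (by simp) (by simp)
    -- the pairs examined after this round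
    have hV : ∀ p' q' u' v', IsPair N p' q' u' v' →
        (V p' q' u' v' ∨ (p' = p ∧ q' = q ∧ u' = u ∧ rank X Y N u v' < rank X Y N u v + 1)) →
        (V p' q' u' v' ∨ (p' = p ∧ q' = q ∧ u' = u ∧ rank X Y N u v' < rank X Y N u v)) ∨
          (p' = p ∧ q' = q ∧ u' = u ∧ v' = v) := by
      rintro p' q' u' v' hpair (h | ⟨h1, h2, h3, h4⟩)
      · exact .inl (.inl h)
      · rcases Nat.lt_succ_iff_lt_or_eq.1 h4 with h5 | h5
        · exact .inl (.inr ⟨h1, h2, h3, h5⟩)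
        · exact .inr ⟨h1, h2, h3, hg.rank_injOn huN hpair.lt_v hv h5⟩
    refine .seq (.natSet (by simp only [NatExp.eval, hv₁]; omega) ?_)
    simp only [NatExp.eval, hv₁]
    have htest : ∀ i j : NatExp, (Test.realLt (xExp i) (xExp j)).Holds (s₁.setNat 15 0 v) ↔
        X (i.eval (s₁.setNat 15 0 v)) < X (j.eval (s₁.setNat 15 0 v)) := by
      intro i j; simp [Test.Holds, RealExp.eval, hx₁]
    refine .ite (fun hb => ?_) fun hb => .ite (fun hb' => ?_) fun hb' => .skip ?_
    all_goals
      rw [htest] at hb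
      simp [NatExp.eval, hu₁] at hb
      try rw [htest] at hb'
      try simp [NatExp.eval, hu₁] at hb'
    · have hpair : IsPair N p q u v := ⟨hpN, hqN, hpq, huN, hv, by rintro rfl; exact lt_irrefl _ hb⟩
      have hside := side_rank_of_lt (X := X) (Y := Y) (N := N) hb
      exact hg.runs_sweepStep hpair hW (by simpa using hp₁) (by simpa using hq₁)
        (by simpa using hu₁) (by simp) ht₂ hB₂ (.inl ⟨rfl, rfl⟩) (by rw [hside]; norm_num)
        (by rw [hside]; norm_num) hside.symm (by simpa using h12) (by simpa using h13) hV
    · have hpair : IsPair N p q u v := ⟨hpN, hqN, hpq, huN, hv,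
        by rintro rfl; exact lt_irrefl _ hb'⟩
      have hside := side_rank_of_gt (X := X) (Y := Y) (N := N) hb'
      refine (hg.runs_sweepStep hpair hW (by simpa using hp₁) (by simpa using hq₁)
        (by simpa using hu₁) (by simp) ht₂ hB₂ (.inr ⟨rfl, rfl⟩) (by rw [hside]; norm_num)
        (τ := 1) (by rw [hside]; norm_num) hside.symm (by simpa using h13) (by simpa using h12)
        hV).mono ?_
      exact fun s' h => ⟨h.2.1, h.1, h.2.2⟩
    · -- neither to the right nor to the left of `u`: the point is `u` itself
      have hvu : v = u := by
        by_contra hne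
        exact hg.x v hv u huN hne (le_antisymm hb hb')
      subst hvu
      have hstep : ∀ σ : ℝ, sweepCost X Y shape obj nb N (orient X Y p q) v σ
          (rank X Y N v v + 1) =
          sweepCost X Y shape obj nb N (orient X Y p q) v σ (rank X Y N v v) := by
        intro σ
        have := hg.sweepCost_add_one hv hv shape obj nb (orient X Y p q) σ
        rw [side_self, mul_zero, neg_zero] at this
        omega
      refine ⟨?_, ?_, hB₂.mono fun p' q' u' v' hpair h => ?_⟩
      · rw [hstep]; simpa using h12
      · rw [hstep]; simpa using h13
      · rcases hV p' q' u' v' hpair h with h | ⟨-, -, rfl, rfl⟩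
        · exact h
        · exact absurd rfl hpair.ne_vu
  · rintro s₁ - - ⟨-, -, h⟩
    refine h.mono fun p' q' u' v' hpair h' => h'.imp_right fun ⟨h1, h2, h3⟩ => ⟨h1, h2, h3, ?_⟩
    exact rank_lt hpair.lt_v

theorem GenPos.runs_search (hg : GenPos X Y N) (hs : Ctx X Y nb N s)
    (hW : (N + 1) * (N + 1) ≤ W) (hB : s.nat 17 0 = (N + 1) * (N + 1)) :
    Runs N W (search shape obj) s (Best X Y shape obj nb N fun _ _ _ _ => True) := by
  have hN : N ≤ W := by nlinarith
  have hN' : N + 1 ≤ W := by nlinarith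
  refine .forLoop (fun k => Best X Y shape obj nb N fun _ _ u' _ => u' < k) hs.all le_rfl hN
    (by simp [Prog.natMods, forLoop]) (by simp [Prog.natMods, forLoop])
    (fun k s v h => h.setNat _ _ (by decide))
    ⟨fun _ _ _ _ _ h => absurd h (by omega), .inl hB⟩ ?_
    fun s₁ _ _ h => h.mono fun _ _ _ _ hp _ => hp.lt_u
  intro u hu s₁ hf hu₁ hB₁
  have hs₁ : Ctx X Y nb N s₁ := hs.frame hf (by simp [Prog.natMods, forLoop])
    (by simp [Prog.natMods, forLoop]) (by simp [Prog.realMods, forLoop])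
    (by simp [Prog.realMods, forLoop])
  refine .seq ((hg.runs_sortBySlope hs₁ hu hu₁ hN').frame.mono ?_)
  rintro s₂ ⟨hf₂, hord⟩
  have hs₂ : Ctx X Y nb N s₂ := hs₁.frame hf₂ (by simp) (by simp) (by simp) (by simp)
  have hu₂ : s₂.nat 2 0 = u := by rw [hf₂.nat 2 (by simp), hu₁]
  have hB₂ := hB₁.frame hf₂ (by simp)
  refine .forLoop (fun k => Best X Y shape obj nb N fun p' _ u' _ => u' < u ∨ (u' = u ∧ p' < k))
    hs₂.all le_rfl hN (by simp [Prog.natMods, forLoop]) (by simp [Prog.natMods, forLoop])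
    (fun k s v h => h.setNat _ _ (by decide)) (hB₂.mono fun _ _ _ _ _ h => by omega) ?_
    fun s₃ _ _ h => h.mono fun _ _ _ _ hp h => by have := hp.lt_p; omega
  intro p hp s₃ hf₃ hp₃ hB₃
  have hs₃ : Ctx X Y nb N s₃ := hs₂.frame hf₃ (by simp [Prog.natMods, forLoop])
    (by simp [Prog.natMods, forLoop]) (by simp [Prog.realMods, forLoop])
    (by simp [Prog.realMods, forLoop])
  refine .forLoop (fun k => Best X Y shape obj nb N fun p' q' u' _ =>
    u' < u ∨ (u' = u ∧ (p' < p ∨ (p' = p ∧ q' < k))))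
    hs₃.all le_rfl hN (by simp [Prog.natMods]) (by simp [Prog.natMods])
    (fun k s v h => h.setNat _ _ (by decide)) (hB₃.mono fun _ _ _ _ _ h => by omega) ?_
    fun s₄ _ _ h => h.mono fun _ _ _ _ hp h => by have := hp.lt_q; omega
  intro q hq s₄ hf₄ hq₄ hB₄
  have hs₄ : Ctx X Y nb N s₄ := hs₃.frame hf₄ (by simp [Prog.natMods])
    (by simp [Prog.natMods]) (by simp [Prog.realMods]) (by simp [Prog.realMods])
  have hu₄ : s₄.nat 2 0 = u := by
    rw [hf₄.nat 2 (by simp [Prog.natMods]), hf₃.nat 2 (by simp [Prog.natMods, forLoop]), hu₂]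
  have hp₄ : s₄.nat 7 0 = p := by rw [hf₄.nat 7 (by simp [Prog.natMods]), hp₃]
  have h6₄ : s₄.nat 6 = s₂.nat 6 := by
    rw [hf₄.nat 6 (by simp [Prog.natMods]), hf₃.nat 6 (by simp [Prog.natMods, forLoop])]
  refine .ite (fun hb => .seq ((hs₄.runs_costTables hu₄ hp₄ hq₄ hW).frame.mono ?_))
    fun hb => .skip ?_
  all_goals simp only [Test.or, Test.Holds, NatExp.eval, hp₄, hq₄] at hb
  · rintro s₅ ⟨hf₅, ht, h12, h13⟩
    have hs₅ : Ctx X Y nb N s₅ := hs₄.frame hf₅ (by simp) (by simp) (by simp) (by simp)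
    refine (hg.runs_sweep hs₅ hp hq (by omega) hu hW (by rw [hf₅.nat 7 (by simp), hp₄])
      (by rw [hf₅.nat 8 (by simp), hq₄]) (by rw [hf₅.nat 2 (by simp), hu₄])
      (by rw [hf₅.nat 6 (by simp), h6₄]; exact hord) ht (hB₄.frame hf₅ (by simp)) h12
      h13).mono fun s' h => h.mono fun _ _ _ _ _ h => by omega
  · exact hB₄.mono fun p' q' _ _ hpair h => by have := hpair.ne_pq; omega

end

/-! ### Reading the input -/

/-- Append the red points to the blue points, and set the number of all points and the initial
value of the best cost. -/
def setup : Prog :=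
  .seq (forLoop 4 0 1 (.seq
    (.realSet 0 (.add (.read 0 (.const 0)) (scalar 4)) (.read 2 (scalar 4)))
    (.realSet 1 (.add (.read 0 (.const 0)) (scalar 4)) (.read 3 (scalar 4)))))
  (.seq (.natSet 1 (.const 0) (.add (.read 0 (.const 0)) (.read 0 (.const 1))))
    (.natSet 17 (.const 0) (.mul (.add (scalar 1) (.const 1)) (.add (scalar 1) (.const 1)))))

/-- Writing the `m`-th entry of `l₂` behind `l₁` and the first `m` entries of `l₂`. -/
theorem update_getD_append {α β : Type*} (l₁ l₂ : List α) (d : α) (f : α → β) (m : ℕ) :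
    Function.update
      (fun i => f (if i < l₁.length + m then (l₁ ++ l₂).getD i d else d)) (l₁.length + m)
      (f (l₂.getD m d)) =
    fun i => f (if i < l₁.length + (m + 1) then (l₁ ++ l₂).getD i d else d) := by
  funext i
  by_cases hi : i = l₁.length + m
  · subst hi
    rw [Function.update_self, if_pos (by omega), List.getD_append_right _ _ _ _ (by omega)]
    simp
  · rw [Function.update_of_ne hi]
    by_cases h : i < l₁.length + m
    · rw [if_pos h, if_pos (by omega)]
    · rw [if_neg h, if_neg (by omega)]

theorem getD_eq_ite_append {α : Type*} (l₁ l₂ : List α) (d : α) (i : ℕ) :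
    l₁.getD i d = if i < l₁.length + 0 then (l₁ ++ l₂).getD i d else d := by
  split_ifs with h
  · rw [List.getD_append _ _ _ _ h]
  · exact List.getD_eq_default _ _ (by omega)

theorem runs_setup (blue red : List Plane) {N W : ℕ} (hN : N = blue.length + red.length)
    (hW : (N + 1) * (N + 1) ≤ W) :
    Runs N W setup (inputState blue red) fun s =>
      Ctx (fun i => ((blue ++ red).getD i 0).1) (fun i => ((blue ++ red).getD i 0).2)
        blue.length N s ∧ s.nat 17 0 = (N + 1) * (N + 1) := by
  have hNW : N ≤ W := by nlinarith
  refine .seq (.forLoop (fun m s =>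
    s.real 0 = (fun i => (if i < blue.length + m then (blue ++ red).getD i 0 else 0).1) ∧
    s.real 1 = (fun i => (if i < blue.length + m then (blue ++ red).getD i 0 else 0).2))
    (m := red.length) (by simp [inputState]) (by omega) (by omega) (by decide) (by decide)
    (fun k s v h => h) ⟨?_, ?_⟩ ?_ ?_)
  · funext i
    simp only [inputState, if_true]
    rw [getD_eq_ite_append blue red]
  · funext i
    simp only [inputState, if_true, one_ne_zero, if_false]
    rw [getD_eq_ite_append blue red]
  · rintro m hm s hf hi ⟨hx, hy⟩
    have h0 : s.nat 0 0 = blue.length := by rw [hf.nat 0 (by decide)]; simp [inputState]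
    have h2 : s.real 2 m = (red.getD m 0).1 := by rw [hf.real 2 (by decide)]; simp [inputState]
    have h3 : s.real 3 m = (red.getD m 0).2 := by rw [hf.real 3 (by decide)]; simp [inputState]
    refine .seq (.realSet (.realSet ⟨?_, ?_⟩))
    · simp only [NatExp.eval, RealExp.eval, State.setReal_real, State.setReal_nat, h0, hi, h2, hx,
        if_true, zero_ne_one, if_false]
      exact update_getD_append blue red 0 Prod.fst m
    · simp only [NatExp.eval, RealExp.eval, State.setReal_real, State.setReal_nat, h0, hi, hy,
        if_true, OfNat.ofNat_ne_zero, if_false, h3]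
      exact update_getD_append blue red 0 Prod.snd m
  · rintro s hf hi ⟨hx, hy⟩
    have h0 : s.nat 0 0 = blue.length := by rw [hf.nat 0 (by decide)]; simp [inputState]
    have h1 : s.nat 0 1 = red.length := by rw [hf.nat 0 (by decide)]; simp [inputState]
    have hall : ∀ i, (if i < blue.length + red.length then (blue ++ red).getD i 0 else 0) =
        (blue ++ red).getD i 0 := by
      intro i
      split_ifs with h
      · rfl
      · exact (List.getD_eq_default _ _ (by simp; omega)).symm
    simp only [hall] at hx hy
    refine .seq (.natSet ?_ (.natSet ?_ ⟨⟨?_, ?_, ?_, ?_⟩, ?_⟩))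
    · simp only [NatExp.eval, h0, h1]; omega
    · simpa [NatExp.eval, h0, h1, ← hN] using hW
    · simpa using hx
    · simpa using hy
    · simpa using h0
    · simp [NatExp.eval, h0, h1, ← hN]
    · simp [NatExp.eval, h0, h1, ← hN]

/-! ### Writing the output -/

/-- Write the line through the points in the variables `p` and `q` to the real array `a`. -/
def storeLine (a p q : ℕ) : Prog :=
  .seq (.realSet a (.const 0) (.sub (.const 0) (.sub (yExp (scalar q)) (yExp (scalar p)))))
    (.seq (.realSet a (.const 1) (.sub (xExp (scalar q)) (xExp (scalar p))))
      (.realSet a (.const 2) (.add (.mul (.read a (.const 0)) (xExp (scalar p)))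
        (.mul (.read a (.const 1)) (yExp (scalar p))))))

theorem Ctx.runs_storeLine {X Y : ℕ → ℝ} {nb N T W : ℕ} {s : State} (hs : Ctx X Y nb N s)
    {a p q : ℕ} (ha : 1 < a) :
    Runs T W (storeLine a p q) s fun s' =>
      lineAt s' a = lineThrough X Y (s.nat p 0) (s.nat q 0) := by
  have ha0 : (0 : ℕ) ≠ a := by omega
  have ha1 : (1 : ℕ) ≠ a := by omega
  refine .seq (.realSet (.seq (.realSet (.realSet ?_))))
  simp [lineAt, lineThrough, RealExp.eval, NatExp.eval, hs.x, hs.y, ha0, ha1]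

/-- The expression computing `Line.det` for the lines in the real arrays `4` and `5`. -/
def detExp : RealExp :=
  .sub (.mul (.read 4 (.const 0)) (.read 5 (.const 1)))
    (.mul (.read 5 (.const 0)) (.read 4 (.const 1)))

/-- The first coordinate relative to the point in the variable `20`. -/
def relX (r : ℕ) : RealExp := .sub (xExp (scalar r)) (xExp (scalar 20))

/-- The square of an expression. -/
def sqExp (e : RealExp) : RealExp := .mul e e

/-- Compute `smallTilt` in the first cell of the real array `6`. -/
def storeTilt : Prog :=
  .seq (.realSet 6 (.const 0) (.add (.const 1) (sqExp (.div (.read 4 (.const 1)) detExp))))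
    (.seq (forLoop 4 1 0 (.realSet 6 (.const 0) (.add (.read 6 (.const 0))
        (sqExp (.div (relX 4) (orientExp (scalar 20) (scalar 21) (scalar 4)))))))
      (.realSet 6 (.const 0) (.div (.const 1) (.read 6 (.const 0)))))

theorem Ctx.runs_storeTilt {X Y : ℕ → ℝ} {nb N W u v : ℕ} {s : State} (hs : Ctx X Y nb N s)
    (hW : N ≤ W) (hu : s.nat 20 0 = u) (hv : s.nat 21 0 = v)
    (hl : lineAt s 5 = lineThrough X Y u v) :
    Runs N W storeTilt s fun s' => s'.real 6 0 = smallTilt X Y N (lineAt s 4) u v := by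
  refine .seq (.realSet (.seq ?_))
  refine .forLoop (fun m s' => s'.real 6 0 =
    1 + ((lineAt s 4).b / (lineAt s 4).det (lineThrough X Y u v)) *
      ((lineAt s 4).b / (lineAt s 4).det (lineThrough X Y u v)) +
    ∑ r ∈ Finset.range m,
      ((X r - X u) / orient X Y u v r) * ((X r - X u) / orient X Y u v r)) (m := N)
    (by simpa using hs.all) le_rfl hW (by decide) (by decide) (fun k s v h => h) ?_ ?_ ?_
  · simp [← hl, lineAt, Line.det, RealExp.eval, NatExp.eval, sqExp, detExp]
  · intro r hr s₁ hf hr₁ h₁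
    have hs₁ : Ctx X Y nb N s₁ := by
      refine Ctx.frame ⟨?_, ?_, ?_, ?_⟩ hf (by decide) (by decide) (by decide) (by decide)
      · simpa using hs.x
      · simpa using hs.y
      · simpa using hs.blue
      · simpa using hs.all
    have hu₁ : s₁.nat 20 0 = u := by rw [hf.nat 20 (by decide)]; simpa using hu
    have hv₁ : s₁.nat 21 0 = v := by rw [hf.nat 21 (by decide)]; simpa using hv
    refine .realSet ?_
    simp only [RealExp.eval, NatExp.eval, sqExp, relX, hs₁.orientExp_eval, State.setReal_real,
      if_true, Function.update_self, h₁, hs₁.x, hu₁, hv₁, hr₁, Finset.sum_range_succ]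
    ring
  · intro s₁ hf hr₁ h₁
    refine .realSet ?_
    simp only [RealExp.eval, NatExp.eval, State.setReal_real, if_true, Function.update_self, h₁,
      smallTilt, Int.cast_one]

/-- Write the best pair of lines to the real arrays `4` and `5`, the second one turned so that it
crosses the first one. -/
def output (shape : Shape) : Prog :=
  .seq (storeLine 4 18 19) (.seq (storeLine 5 20 21) (.seq storeTilt (.seq
    (.ite (badTest shape (scalar 21) (orientExp (scalar 18) (scalar 19) (scalar 21)) (relX 21))
      (.realSet 6 (.const 0) (.sub (.const 0) (.read 6 (.const 0)))) .skip)
    (.seq (.realSet 5 (.const 0) (.add (.read 5 (.const 0)) (.read 6 (.const 0))))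
      (.realSet 5 (.const 2) (.add (.read 5 (.const 2))
        (.mul (.read 6 (.const 0)) (xExp (scalar 20)))))))))

theorem Ctx.runs_output {X Y : ℕ → ℝ} {nb N W p q u v : ℕ} {s : State} (hs : Ctx X Y nb N s)
    (shape : Shape) (hW : N ≤ W) (hp : s.nat 18 0 = p) (hq : s.nat 19 0 = q)
    (hu : s.nat 20 0 = u) (hv : s.nat 21 0 = v) :
    Runs N W (output shape) s fun s' =>
      lineAt s' 4 = lineThrough X Y p q ∧
      ∃ ε, lineAt s' 5 = (lineThrough X Y u v).tilt ε (X u) ∧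
        ((Bad shape (v < nb) (orient X Y p q v) (X v - X u) ∧
          ε = -smallTilt X Y N (lineThrough X Y p q) u v) ∨
        (¬ Bad shape (v < nb) (orient X Y p q v) (X v - X u) ∧
          ε = smallTilt X Y N (lineThrough X Y p q) u v)) := by
  refine .seq ((hs.runs_storeLine (by decide)).frame.mono ?_)
  rintro s₁ ⟨hf₁, h₁⟩
  have hs₁ : Ctx X Y nb N s₁ := hs.frame hf₁ (by decide) (by decide) (by decide) (by decide)
  refine .seq ((hs₁.runs_storeLine (by decide)).frame.mono ?_)
  rintro s₂ ⟨hf₂, h₂⟩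
  have hs₂ : Ctx X Y nb N s₂ := hs₁.frame hf₂ (by decide) (by decide) (by decide) (by decide)
  have hn₂ : ∀ a, s₂.nat a = s.nat a := fun a => by
    rw [hf₂.nat a (by simp [storeLine, Prog.natMods]),
      hf₁.nat a (by simp [storeLine, Prog.natMods])]
  have h4₂ : lineAt s₂ 4 = lineThrough X Y p q := by
    rw [lineAt, hf₂.real 4 (by decide), ← hp, ← hq]; exact h₁
  rw [hf₁.nat 20 (by decide), hf₁.nat 21 (by decide), hu, hv] at h₂
  refine .seq ((hs₂.runs_storeTilt hW (by rw [hn₂, hu]) (by rw [hn₂, hv]) h₂).frame.mono ?_)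
  rintro s₃ ⟨hf₃, h₃⟩
  have hs₃ : Ctx X Y nb N s₃ := hs₂.frame hf₃ (by decide) (by decide) (by decide) (by decide)
  have hp₃ : s₃.nat 18 0 = p := by rw [hf₃.nat 18 (by decide), hn₂, hp]
  have hq₃ : s₃.nat 19 0 = q := by rw [hf₃.nat 19 (by decide), hn₂, hq]
  have hu₃ : s₃.nat 20 0 = u := by rw [hf₃.nat 20 (by decide), hn₂, hu]
  have hv₃ : s₃.nat 21 0 = v := by rw [hf₃.nat 21 (by decide), hn₂, hv]
  have h4₃ : lineAt s₃ 4 = lineThrough X Y p q := by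
    rw [lineAt, hf₃.real 4 (by decide)]; exact h4₂
  have h5₃ : lineAt s₃ 5 = lineThrough X Y u v := by
    rw [lineAt, hf₃.real 5 (by decide)]; exact h₂
  rw [h4₂] at h₃
  have htest := hs₃.badTest_holds shape (scalar 21)
    (orientExp (scalar 18) (scalar 19) (scalar 21)) (relX 21)
  simp only [hs₃.orientExp_eval, relX, RealExp.eval, NatExp.eval, hs₃.x, hp₃, hq₃, hu₃, hv₃]
    at htest
  rw [← h5₃]
  refine .seq (.ite (fun hb => .realSet (.seq (.realSet (.realSet ⟨?_, _, ?_,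
    .inl ⟨htest.1 hb, rfl⟩⟩)))) fun hb => .skip (.seq (.realSet (.realSet ⟨?_, _, ?_,
    .inr ⟨fun h => hb (htest.2 h), rfl⟩⟩))))
  · rw [← h4₃]; simp [lineAt]
  · simp [lineAt, Line.tilt, RealExp.eval, NatExp.eval, h₃, hu₃, hs₃.x]
  · rw [← h4₃]; simp [lineAt]
  · simp [lineAt, Line.tilt, RealExp.eval, NatExp.eval, h₃, hu₃, hs₃.x]

/-! ### Point sets and their enumerations -/

theorem sum_map_eq_sum_range {α : Type*} (l : List α) (d : α) (f : α → ℕ) :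
    (l.map f).sum = ∑ i ∈ Finset.range l.length, f (l.getD i d) := by
  induction l with
  | nil => simp
  | cons a l ih => simp [Finset.sum_range_succ', ih, add_comm]

theorem Enumerates.sum_eq {l : List Plane} {S : Finset Plane} (h : Enumerates l S)
    (f : Plane → ℕ) : ∑ p ∈ S, f p = ∑ i ∈ Finset.range l.length, f (l.getD i 0) := by
  classical
  rw [← sum_map_eq_sum_range, ← List.sum_toFinset f h.1]
  congr 1
  ext p
  rw [List.mem_toFinset, h.2]

theorem Enumerates.length_eq {l : List Plane} {S : Finset Plane} (h : Enumerates l S) :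
    l.length = S.card := by
  have := h.sum_eq fun _ => 1
  simpa using this.symm

/-- The cost is the weighted sum of the numbers of outliers. -/
theorem totalCost_eq {blue red : List Plane} {B R : Finset Plane} (hB : Enumerates blue B)
    (hR : Enumerates red R) {shape : Shape} (obj : Objective) {l m : Line} (h : Crossing l m)
    {N : ℕ} (hN : N = blue.length + red.length) :
    totalCost shape obj blue.length N (fun r => l.eval ((blue ++ red).getD r 0))
      (fun r => m.eval ((blue ++ red).getD r 0)) =
    weight obj N True * blueOutliers B (region shape l m) +
      weight obj N False * redOutliers R (region shape l m) := by
  classical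
  rw [blueOutliers_region, redOutliers_region h, hB.sum_eq, hR.sum_eq, totalCost]
  nth_rewrite 1 [hN]
  rw [Finset.sum_range_add, Finset.mul_sum, Finset.mul_sum]
  congr 1
  · refine Finset.sum_congr rfl fun i hi => ?_
    have hi : i < blue.length := Finset.mem_range.1 hi
    rw [List.getD_append _ _ _ _ hi]
    simp [cost, Bad, hi]
  · refine Finset.sum_congr rfl fun i _ => ?_
    rw [List.getD_append_right _ _ _ _ (by omega), Nat.add_sub_cancel_left]
    simp [cost, Bad]

theorem collinear_of_orient_eq_zero {p q r : Plane} (hpq : p.1 ≠ q.1)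
    (h : (q.1 - p.1) * (r.2 - p.2) - (q.2 - p.2) * (r.1 - p.1) = 0) :
    Collinear ℝ ({p, q, r} : Set Plane) := by
  have hne : q.1 - p.1 ≠ 0 := sub_ne_zero.2 hpq.symm
  rw [collinear_iff_of_mem (p₀ := p) (by simp)]
  refine ⟨q - p, ?_⟩
  simp only [Set.mem_insert_iff, Set.mem_singleton_iff, forall_eq_or_imp, forall_eq]
  refine ⟨⟨0, by simp⟩, ⟨1, by simp⟩, (r.1 - p.1) / (q.1 - p.1), ?_⟩
  ext
  · simp only [vadd_eq_add, Prod.fst_add, Prod.smul_fst, Prod.fst_sub, smul_eq_mul]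
    rw [div_mul_cancel₀ _ hne]; ring
  · simp only [vadd_eq_add, Prod.snd_add, Prod.smul_snd, Prod.snd_sub, smul_eq_mul]
    rw [div_mul_eq_mul_div, ← sub_eq_iff_eq_add, eq_div_iff hne]
    linear_combination h

theorem GeneralPosition.genPos {B R : Finset Plane} (h : GeneralPosition B R)
    {blue red : List Plane} (hB : Enumerates blue B) (hR : Enumerates red R) :
    GenPos (fun i => ((blue ++ red).getD i 0).1) (fun i => ((blue ++ red).getD i 0).2)
      (blue.length + red.length) := by
  obtain ⟨hd, hx, hy, hc⟩ := h
  have hnodup : (blue ++ red).Nodup := hB.1.append hR.1 fun p hp hp' =>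
    Finset.disjoint_left.1 hd ((hB.2 p).1 hp) ((hR.2 p).1 hp')
  have hget : ∀ i, i < blue.length + red.length → ∃ h : i < (blue ++ red).length,
      (blue ++ red).getD i 0 = (blue ++ red)[i] := fun i hi =>
    ⟨by simpa using hi, List.getD_eq_getElem _ _ _⟩
  have hmem : ∀ i, i < blue.length + red.length → (blue ++ red).getD i 0 ∈ B ∪ R := by
    intro i hi
    obtain ⟨h, e⟩ := hget i hi
    rw [e, Finset.mem_union, ← hB.2, ← hR.2, ← List.mem_append]
    exact List.getElem_mem h
  have hne : ∀ i, i < blue.length + red.length → ∀ j, j < blue.length + red.length → i ≠ j →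
      (blue ++ red).getD i 0 ≠ (blue ++ red).getD j 0 := by
    intro i hi j hj hij
    obtain ⟨h, e⟩ := hget i hi
    obtain ⟨h', e'⟩ := hget j hj
    rw [e, e']
    exact fun he => hij (hnodup.getElem_inj_iff.1 he)
  refine ⟨fun i hi j hj hij he => ?_, fun i hi j hj hij he => ?_,
    fun i hi j hj k hk hij hik hjk he => ?_⟩
  · exact hne i hi j hj hij (hx (hmem i hi) (hmem j hj) he)
  · exact hne i hi j hj hij (hy (hmem i hi) (hmem j hj) he)
  · refine hc _ (hmem i hi) _ (hmem j hj) _ (hmem k hk) (hne i hi j hj hij) (hne i hi k hk hik)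
      (hne j hj k hk hjk) (collinear_of_orient_eq_zero (fun h => ?_) he)
    exact hne i hi j hj hij (hx (hmem i hi) (hmem j hj) h)

/-! ### Optimality -/

theorem Crossing.normal_left {l m : Line} (h : Crossing l m) : l.a ≠ 0 ∨ l.b ≠ 0 := by
  by_contra! h0
  exact h (by rw [h0.1, h0.2]; ring)

theorem Crossing.normal_right {l m : Line} (h : Crossing l m) : m.a ≠ 0 ∨ m.b ≠ 0 := by
  by_contra! h0
  exact h (by rw [h0.1, h0.2]; ring)

/-- Some pair of lines through two points each costs at most as much as two given crossing lines. -/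
theorem GenPos.exists_isPair_totalCost_le {X Y : ℕ → ℝ} {N nb : ℕ} (hg : GenPos X Y N)
    (hN : 3 ≤ N) (shape : Shape) (obj : Objective) {l m : Line} (h : Crossing l m) :
    ∃ p q u v, IsPair N p q u v ∧
      totalCost shape obj nb N (orient X Y p q) (orient X Y u v) ≤
      totalCost shape obj nb N (fun r => l.eval (X r, Y r)) (fun r => m.eval (X r, Y r)) := by
  obtain ⟨p, hp, q, hq, hpq, h₁⟩ := hg.exists_pair hN l.c h.normal_left
  obtain ⟨u, hu, v, hv, huv, h₂⟩ := hg.exists_pair hN m.c h.normal_right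
  refine ⟨p, q, u, v, ⟨hp, hq, hpq, hu, hv, huv.symm⟩, Finset.sum_le_sum fun r hr =>
    cost_mono fun hb => ?_⟩
  have hr := Finset.mem_range.1 hr
  exact hb.mono (h₁ r hr).1 (h₁ r hr).2 (h₂ r hr).1 (h₂ r hr).2

theorem exists_forall_lt (S : Finset Plane) : ∃ M : ℝ, ∀ p ∈ S, p.1 < M ∧ p.2 < M := by
  classical
  obtain ⟨M, hM⟩ := (S.image fun p : Plane => |p.1| + |p.2|).exists_le
  refine ⟨M + 1, fun p hp => ?_⟩
  have := hM _ (Finset.mem_image_of_mem _ hp)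
  constructor
  · linarith [le_abs_self p.1, abs_nonneg p.2]
  · linarith [le_abs_self p.2, abs_nonneg p.1]

/-- Some region contains all blue points in its interior. -/
theorem exists_blueOutliers_eq_zero (shape : Shape) (B : Finset Plane) :
    ∃ l m, Crossing l m ∧ blueOutliers B (region shape l m) = 0 := by
  classical
  obtain ⟨M, hM⟩ := exists_forall_lt B
  refine ⟨⟨1, 0, M⟩, ⟨0, 1, M⟩, by simp [Crossing], ?_⟩
  rw [blueOutliers_region]
  refine Finset.sum_eq_zero fun p hp => if_neg ?_
  have h := hM p hp
  have h1 : (⟨1, 0, M⟩ : Line).eval p < 0 := by simp [Line.eval, h.1]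
  have h2 : (⟨0, 1, M⟩ : Line).eval p < 0 := by simp [Line.eval, h.2]
  cases shape
  · exact not_or.2 ⟨h1.not_gt, h2.not_gt⟩
  · exact (mul_pos_of_neg_of_neg h1 h2).not_gt

/-- Some region is disjoint from the set of the red points. -/
theorem exists_redOutliers_eq_zero (shape : Shape) (R : Finset Plane) :
    ∃ l m, Crossing l m ∧ redOutliers R (region shape l m) = 0 := by
  classical
  obtain ⟨M, hM⟩ := exists_forall_lt R
  have hc : Crossing ⟨1, 0, M⟩ ⟨0, -1, -M⟩ := by simp [Crossing]
  refine ⟨⟨1, 0, M⟩, ⟨0, -1, -M⟩, hc, ?_⟩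
  rw [redOutliers_region hc]
  refine Finset.sum_eq_zero fun p hp => if_neg ?_
  have h := hM p hp
  have h1 : (⟨1, 0, M⟩ : Line).eval p < 0 := by simp [Line.eval, h.1]
  have h2 : 0 < (⟨0, -1, -M⟩ : Line).eval p := by simp [Line.eval, h.2]
  cases shape
  · exact fun h' => h2.not_gt h'.2
  · exact (mul_neg_of_neg_of_pos h1 h2).not_gt

theorem redOutliers_le (R : Finset Plane) (W : Set Plane) : redOutliers R W ≤ R.card :=
  (Set.ncard_inter_le_ncard_left _ _).trans (Set.ncard_coe_finset R).le

theorem blueOutliers_le (B : Finset Plane) (W : Set Plane) : blueOutliers B W ≤ B.card :=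
  (Set.ncard_inter_le_ncard_left _ _).trans (Set.ncard_coe_finset B).le

/-- Minimizing the weighted number of outliers solves all three problems. -/
theorem isOptimal_of_forall_le {shape : Shape} {obj : Objective} {B R : Finset Plane} {N : ℕ}
    (hB : B.card ≤ N) (hR : R.card ≤ N) {l m : Line} (h : Crossing l m)
    (hle : ∀ l' m', Crossing l' m' →
      weight obj N True * blueOutliers B (region shape l m) +
        weight obj N False * redOutliers R (region shape l m) ≤
      weight obj N True * blueOutliers B (region shape l' m') +
        weight obj N False * redOutliers R (region shape l' m')) :
    IsOptimal shape obj B R (region shape l m) := by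
  refine ⟨isRegion_iff.2 ⟨l, m, h, rfl⟩, ?_, ?_⟩
  · cases obj
    · obtain ⟨l', m', hc, h0⟩ := exists_blueOutliers_eq_zero shape B
      have h1 := hle l' m' hc
      have h2 := redOutliers_le R (region shape l' m')
      simp only [weight, if_true, if_false, h0] at h1
      change blueOutliers B _ = 0
      by_contra h3
      have := Nat.le_mul_of_pos_right (N + 1) (Nat.pos_of_ne_zero h3)
      omega
    · obtain ⟨l', m', hc, h0⟩ := exists_redOutliers_eq_zero shape R
      have h1 := hle l' m' hc
      have h2 := blueOutliers_le B (region shape l' m')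
      simp only [weight, if_true, if_false, h0] at h1
      change redOutliers R _ = 0
      by_contra h3
      have := Nat.le_mul_of_pos_right (N + 1) (Nat.pos_of_ne_zero h3)
      omega
    · trivial
  · intro W' hW' hf
    obtain ⟨l', m', hc, rfl⟩ := isRegion_iff.1 hW'
    have h1 := hle l' m' hc
    cases obj
    · have h0 : blueOutliers B (region shape l' m') = 0 := hf
      simp only [weight, if_true, if_false, h0] at h1
      change redOutliers R _ ≤ redOutliers R _
      omega
    · have h0 : redOutliers R (region shape l' m') = 0 := hf
      simp only [weight, if_true, if_false, h0] at h1
      change blueOutliers B _ ≤ blueOutliers B _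
      omega
    · simp only [weight] at h1
      change redOutliers R _ + blueOutliers B _ ≤ redOutliers R _ + blueOutliers B _
      omega

/-- The program that finds an optimal region: the best pair of lines through two points each, made
crossing. -/
def algorithm (shape : Shape) (obj : Objective) : Prog :=
  .seq setup (.seq (search shape obj) (output shape))

theorem algorithm_depth (shape : Shape) (obj : Objective) : (algorithm shape obj).depth = 4 := rfl

theorem runs_algorithm (shape : Shape) (obj : Objective) {B R : Finset Plane}
    (h3 : 3 ≤ (B ∪ R).card) (hgen : GeneralPosition B R) {blue red : List Plane}
    (hB : Enumerates blue B) (hR : Enumerates red R) {N W : ℕ}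
    (hN : N = blue.length + red.length) (hW : (N + 1) * (N + 1) ≤ W) :
    Runs N W (algorithm shape obj) (inputState blue red) fun s =>
      Crossing (lineAt s 4) (lineAt s 5) ∧
      IsOptimal shape obj B R (region shape (lineAt s 4) (lineAt s 5)) := by
  let X : ℕ → ℝ := fun i => ((blue ++ red).getD i 0).1
  let Y : ℕ → ℝ := fun i => ((blue ++ red).getD i 0).2
  have hg : GenPos X Y N := hN ▸ hgen.genPos hB hR
  have hN3 : 3 ≤ N := by
    rw [hN, hB.length_eq, hR.length_eq, ← Finset.card_union_of_disjoint hgen.1]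
    exact h3
  have hNW : N ≤ W := by nlinarith
  have hsetup : Runs N W setup (inputState blue red) fun s =>
    Ctx X Y blue.length N s ∧ s.nat 17 0 = (N + 1) * (N + 1) := runs_setup blue red hN hW
  refine .seq (hsetup.mono ?_)
  rintro s₁ ⟨hs₁, h17⟩
  refine .seq ((hg.runs_search (shape := shape) (obj := obj) hs₁ hW h17).frame.mono ?_)
  rintro s₂ ⟨hf₂, hbest⟩
  have hs₂ := hs₁.frame hf₂ (by simp [search, Prog.natMods, forLoop])
    (by simp [search, Prog.natMods, forLoop]) (by simp [search, Prog.realMods, forLoop])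
    (by simp [search, Prog.realMods, forLoop])
  -- some pair has been examined, so the initial value of the best cost has been replaced
  obtain ⟨hpair, hcost⟩ := hbest.eq.resolve_left fun h => by
    have h1 := hbest.le 0 1 0 1 ⟨by omega, by omega, by omega, by omega, by omega, by omega⟩ trivial
    have h2 := totalCost_le (shape := shape) (obj := obj) (nb := blue.length) (N := N)
      (orient X Y 0 1) (orient X Y 0 1)
    rw [h] at h1
    have h3 : (N + 1) * (N + 1) = N * (N + 1) + (N + 1) := by ring
    omega
  refine (hs₂.runs_output shape hNW rfl rfl rfl rfl).mono ?_
  rintro s₃ ⟨h4, ε, h5, hε⟩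
  have hbne : (lineThrough X Y (s₂.nat 18 0) (s₂.nat 19 0)).b ≠ 0 :=
    sub_ne_zero.2 (hg.x _ hpair.lt_q _ hpair.lt_p hpair.ne_pq.symm)
  have hpos := smallTilt_pos X Y N (lineThrough X Y (s₂.nat 18 0) (s₂.nat 19 0)) (s₂.nat 20 0)
    (s₂.nat 21 0)
  have hcross : Crossing (lineAt s₃ 4) (lineAt s₃ 5) := by
    rw [h4, h5]
    refine crossing_tilt (N := N) hbne ?_
    rcases hε with ⟨-, rfl⟩ | ⟨-, rfl⟩
    · rw [abs_neg, abs_of_pos hpos]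
    · rw [abs_of_pos hpos]
  refine ⟨hcross, isOptimal_of_forall_le (N := N) ?_ ?_ hcross fun l' m' hc => ?_⟩
  · rw [← hB.length_eq]; omega
  · rw [← hR.length_eq]; omega
  · rw [← totalCost_eq hB hR obj hcross hN, ← totalCost_eq hB hR obj hc hN]
    obtain ⟨p, q, u, v, hp, hle⟩ := hg.exists_isPair_totalCost_le (nb := blue.length) hN3 shape obj
      hc
    refine le_trans ?_ ((hbest.le p q u v hp trivial).trans hle)
    have hF : (fun r => (lineAt s₃ 4).eval ((blue ++ red).getD r 0)) =
        orient X Y (s₂.nat 18 0) (s₂.nat 19 0) :=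
      funext fun r => by rw [h4]; exact lineThrough_eval X Y _ _ r
    rw [hcost, hF, h5]
    exact totalCost_tilt_le hg hpair.lt_u hpair.lt_v hpair.ne_vu.symm _ hε

end BichromaticSeparation

theorem mainTheorem8 (shape : BichromaticSeparation.Shape)
    (obj : BichromaticSeparation.Objective) :
    ∃ (P : BichromaticSeparation.Prog) (C : ℕ),
      ∀ (n : ℕ) (B R : Finset BichromaticSeparation.Plane),
        B.card ≤ n → R.card ≤ n → 3 ≤ (B ∪ R).card →
        BichromaticSeparation.GeneralPosition B R →
        ∀ (blue red : List BichromaticSeparation.Plane),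
          BichromaticSeparation.Enumerates blue B →
          BichromaticSeparation.Enumerates red R →
          ∃ (t : ℕ) (s : BichromaticSeparation.State),
            BichromaticSeparation.Exec (C * n ^ 4) P
              (BichromaticSeparation.inputState blue red) t s ∧
            t ≤ C * n ^ 4 ∧
            BichromaticSeparation.Crossing (BichromaticSeparation.lineAt s 4)
              (BichromaticSeparation.lineAt s 5) ∧
            BichromaticSeparation.IsOptimal shape obj B R
              (BichromaticSeparation.region shape (BichromaticSeparation.lineAt s 4)
                (BichromaticSeparation.lineAt s 5)) := by
  set P := BichromaticSeparation.algorithm shape obj with hP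
  refine ⟨P, P.coef * 16 + 9, fun n B R hBn hRn h3 hgen blue red hB hR => ?_⟩
  have hcard : (B ∪ R).card = blue.length + red.length := by
    rw [hB.length_eq, hR.length_eq, Finset.card_union_of_disjoint hgen.1]
  -- the loops run over all points, of which there may be `2 * n`
  have hN : blue.length + red.length ≤ 2 * n := by rw [hB.length_eq, hR.length_eq]; omega
  have hn : 1 ≤ n := by omega
  have hW : (blue.length + red.length + 1) * (blue.length + red.length + 1) ≤
      (P.coef * 16 + 9) * n ^ 4 := by
    have h2 : n ^ 2 ≤ n ^ 4 := Nat.pow_le_pow_right hn (by omega)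
    calc (blue.length + red.length + 1) * (blue.length + red.length + 1)
        ≤ (3 * n) * (3 * n) := Nat.mul_le_mul (by omega) (by omega)
      _ = 9 * n ^ 2 := by ring
      _ ≤ 9 * n ^ 4 := Nat.mul_le_mul_left _ h2
      _ ≤ (P.coef * 16 + 9) * n ^ 4 := Nat.mul_le_mul_right _ (by omega)
  obtain ⟨t, s, hexec, ht, hcross, hopt⟩ :=
    BichromaticSeparation.runs_algorithm shape obj h3 hgen hB hR rfl hW
  refine ⟨t, s, hexec, ?_, hcross, hopt⟩
  calc t ≤ P.bound (blue.length + red.length) := ht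
    _ ≤ P.coef * (blue.length + red.length) ^ P.depth :=
      BichromaticSeparation.Prog.bound_le (by omega) P
    _ = P.coef * (blue.length + red.length) ^ 4 := by
      rw [hP, BichromaticSeparation.algorithm_depth]
    _ ≤ P.coef * (2 * n) ^ 4 := Nat.mul_le_mul_left _ (Nat.pow_le_pow_left hN 4)
    _ = P.coef * 16 * n ^ 4 := by ring
    _ ≤ (P.coef * 16 + 9) * n ^ 4 := Nat.mul_le_mul_right _ (by omega)
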